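/- Setting. Let $\rho$ be a distribution of prompts on $\mathcal X$, $\mathcal Y$ a countable set of responses, and let a policy $\pi$ assign to each prompt $x$ a distribution $\pi(\cdot|x)$ on $\mathcal Y$. Let $\pi_{\rm ref}$ be a reference policy and $\pi_{\rm sam}$ a fixed sampler with $\pi_{\rm sam}(\cdot|x)\ll\pi_{\rm ref}(\cdot|x)$ for $\rho$-almost every $x$. Let $\mathcal R$ be a finite class of rewards $r_\theta(x,y)=\langle\phi(x,y),\theta\rangle$ with $\phi:\mathcal X\times\mathcal Y\to\mathbb R^d$, $d\ge1$, $\phi(\cdot,y)$ $\rho$-integrable for every $y$, $\|\phi(x,y)-\phi(x,y')\|_2\le1$ for all $x,y,y'$ and $\|\theta\|_2\le R_{\max}$, $R_{\max}\ge1$. Assume $r^\star\in\mathcal R$ for the true reward $r^\star$. With $\sigma$ the sigmoid function, preferences follow the Bradley–Terry model $\mathbb P^\star(y\succ y'|x)=\sigma(r^\star(x,y)-r^\star(x,y'))$. Fix $\beta>0$. For $r\in\mathcal R$ let $\pi(r)$ maximize $J(r,\pi)=\mathbb E_{x\sim\rho,\,y\sim\pi(\cdot|x)}\big[r(x,y)-\beta\log\frac{\pi(y|x)}{\pi_{\rm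 ref}(y|x)}\big]$ over all policies and put $\Pi=\{\pi(r):r\in\mathcal R\}$; let $\pi^\star_r$ maximize $\mathbb E_{x\sim\rho,\,y\sim\pi(\cdot|x)}[r(x,y)]$ over all policies, and $\pi^\star=\pi^\star_{r^\star}$ (such maximizers are assumed to exist). Algorithm (POPO with the lightweight bonus). Start with $\pi_1=\pi_{\rm ref}$. In round $t=1,\dots,T$ draw $x_t\sim\rho$, $y^1_t\sim\pi_t(\cdot|x_t)$, $y^2_t\sim\pi_{\rm sam}(\cdot|x_t)$, let $(y^w_t,y^l_t)$ be the two responses ordered by a label drawn from $\mathrm{Ber}(\mathbb P^\star(y^1_t\succ y^2_t|x_t))$, let $\mathcal D_t$ be the data of rounds $1,\dots,t$, and choose $$\pi_{t+1}\in\arg\max_{\pi\in\Pi}\big\{-\ell(\pi,\mathcal D_t)+\alpha H(\pi)\,\mathbb 1\{\ell(\pi,\mathcal D_t)-\min_{\pi'\in\Pi}\ell(\pi',\mathcal D_t)\le\gamma\}\big\},$$ where $\ell(\pi,\mathcal D_t)=-\sum_{s\le t}\log\sigma\big(\beta\log\frac{\pi(y^w_s|x_s)}{\pi_{\rm ref}(y^w_s|x_s)}-\beta\log\frac{\pi(y^l_s|x_s)}{\pi_{\rm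 ref}(y^l_s|x_s)}\big)$ and $H(\pi)=\mathbb E_{x\sim\rho,\,y'\sim\pi_{\rm sam}(\cdot|x)}\big[\sigma\big(-\beta\log\frac{\pi(y'|x)}{\pi_{\rm ref}(y'|x)}\big)\big]$. Theorem. There is an absolute constant $C>0$ such that, for every such setting, every $0<\delta<1$ and every $T\ge 2d$, if $\alpha=\sqrt{\frac{T\log(|\mathcal R|/\delta)}{d\,R_{\max}\log(T/d)}}$ and $\gamma=2\log\frac{|\mathcal R|}{\delta}$, then with probability at least $1-2\delta$ the regret $$\mathrm{Reg}_{\rm pref}(\pi_{\rm sam},T)=\sum_{t=1}^T\mathbb E_{x\sim\rho,\,(y^\star,y,y')\sim\pi^\star\otimes\pi_t\otimes\pi_{\rm sam}(\cdot|x)}\big[\mathbb P^\star(y^\star\succ y'|x)-\mathbb P^\star(y\succ y'|x)\big]$$ satisfies $$\mathrm{Reg}_{\rm pref}(\pi_{\rm sam},T)\le C\Big(\sqrt{dR_{\max}T\log\tfrac{TR_{\max}}{d}\log\tfrac{|\mathcal R|}{\delta}}+d\,e^{R_{\max}}\log\tfrac{TR_{\max}}{d}\log\tfrac{|\mathcal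 R|}{\delta}+\beta T\,C'_{\rm KL}\Big),$$ where $C'_{\rm KL}=\max_{r\in\mathcal R}\mathbb E_{x\sim\rho}\big[\mathbb D_{\rm KL}(\pi^\star_r(\cdot|x)\,\|\,\pi_{\rm ref}(\cdot|x))\big]\in[0,\infty]$. -/

import Mathlib

open MeasureTheory ProbabilityTheory
open scoped ENNReal

noncomputable section

namespace POPO

/-- A policy: a Markov kernel `x ↦ π(· | x)` from prompts to responses. -/
structure Policy (X Y : Type*) [MeasurableSpace X] [MeasurableSpace Y] where
  kernel : Kernel X Y
  isMarkovKernel : IsMarkovKernel kernel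

attribute [instance] Policy.isMarkovKernel

section

variable {X Y : Type*} [MeasurableSpace X] [MeasurableSpace Y]

/-- The response distribution `π(· | x)`. -/
def Policy.at (π : Policy X Y) (x : X) : Measure Y := π.kernel x

/-- The probability `π(y | x)`. -/
def Policy.prob (π : Policy X Y) (x : X) (y : Y) : ℝ := (π.at x).real {y}

/-- The log-ratio `log (π(y | x) / π_ref(y | x))`. -/
def logRatio (πref π : Policy X Y) (x : X) (y : Y) : ℝ :=
  Real.log (π.prob x y / πref.prob x y)

/-- The Bradley–Terry preference `ℙ_r(y ≻ y' | x) = σ(r(x,y) - r(x,y'))`. -/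
def pref (r : X → Y → ℝ) (x : X) (y y' : Y) : ℝ := Real.sigmoid (r x y - r x y')

/-- The expected reward `𝔼_{x ∼ ρ, y ∼ π(·|x)} [r(x,y)]`. -/
def expReward (ρ : Measure X) (r : X → Y → ℝ) (π : Policy X Y) : ℝ :=
  ∫ x, ∫ y, r x y ∂(π.at x) ∂ρ

/-- The expected divergence `𝔼_{x ∼ ρ} [KL(π(·|x) ‖ π_ref(·|x))]`, with values in `[0, ∞]`. -/
def expKL (ρ : Measure X) (π πref : Policy X Y) : ℝ≥0∞ :=
  ∫⁻ x, InformationTheory.klDiv (π.at x) (πref.at x) ∂ρ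

/-- The KL-regularized objective
`J(r, π) = 𝔼_{x ∼ ρ, y ∼ π(·|x)} [r(x,y) - β log (π(y|x) / π_ref(y|x))]`. It takes the value `-∞`
exactly when the expected divergence is infinite (for `β > 0`). -/
def J (ρ : Measure X) (β : ℝ) (πref : Policy X Y) (r : X → Y → ℝ) (π : Policy X Y) : EReal :=
  ((expReward ρ r π : ℝ) : EReal) - ((ENNReal.ofReal β * expKL ρ π πref : ℝ≥0∞) : EReal)

/-- `π ∈ argmax J(r, ·)` over all policies. -/
def IsRegularizedOptimal (ρ : Measure X) (β : ℝ) (πref : Policy X Y) (r : X → Y → ℝ)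
    (π : Policy X Y) : Prop :=
  ∀ π' : Policy X Y, J ρ β πref r π' ≤ J ρ β πref r π

/-- `π ∈ argmax 𝔼_{x ∼ ρ, y ∼ ·} [r(x,y)]` over all policies. -/
def IsRewardOptimal (ρ : Measure X) (r : X → Y → ℝ) (π : Policy X Y) : Prop :=
  ∀ π' : Policy X Y, expReward ρ r π' ≤ expReward ρ r π

/-- One labelled comparison `((x, y¹, y²), o)`; `o = true` means that `y¹` is preferred to `y²`. -/
abbrev Sample (X Y : Type*) : Type _ := (X × Y × Y) × Bool

/-- The prompt of a comparison. -/
def Sample.prompt (z : Sample X Y) : X := z.1.1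

/-- The preferred response `y^w`. -/
def Sample.winner (z : Sample X Y) : Y := if z.2 then z.1.2.1 else z.1.2.2

/-- The other response `y^l`. -/
def Sample.loser (z : Sample X Y) : Y := if z.2 then z.1.2.2 else z.1.2.1

/-- The DPO loss `ℓ(π, D)` of `π` on the data set `D` made of the first `n` terms of `z`. -/
def dpoLoss (β : ℝ) (πref π : Policy X Y) (z : ℕ → Sample X Y) (n : ℕ) : ℝ :=
  -∑ s ∈ Finset.range n, Real.log (Real.sigmoid
      (β * logRatio πref π (z s).prompt (z s).winner
        - β * logRatio πref π (z s).prompt (z s).loser))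

/-- The lightweight bonus
`H(π) = 𝔼_{x ∼ ρ, y' ∼ π_sam(·|x)} [σ(-β log (π(y'|x) / π_ref(y'|x)))]`. -/
def lightBonus (ρ : Measure X) (β : ℝ) (πref πsam π : Policy X Y) : ℝ :=
  ∫ x, ∫ y', Real.sigmoid (-(β * logRatio πref π x y')) ∂(πsam.at x) ∂ρ

open Classical in
/-- The truncation `I(π, D) = 𝟙{ℓ(π, D) - ℓ(π̄, D) ≤ γ}`, where `π̄` minimizes `ℓ(·, D)` over the
finite policy class `Pi`; comparing with the minimizer is comparing with every member. -/
def truncation (β γ : ℝ) (πref : Policy X Y) (Pi : Set (Policy X Y)) (π : Policy X Y)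
    (z : ℕ → Sample X Y) (n : ℕ) : ℝ :=
  if ∀ π' ∈ Pi, dpoLoss β πref π z n - dpoLoss β πref π' z n ≤ γ then 1 else 0

/-- The objective `-ℓ(π, D) + α H(π) I(π, D)`. -/
def objective (ρ : Measure X) (β α γ : ℝ) (πref πsam : Policy X Y) (Pi : Set (Policy X Y))
    (π : Policy X Y) (z : ℕ → Sample X Y) (n : ℕ) : ℝ :=
  -dpoLoss β πref π z n + α * lightBonus ρ β πref πsam π * truncation β γ πref Pi π z n

/-- The law of one comparison when the first response comes from `π`: `x ∼ ρ`, `y¹ ∼ π(·|x)` and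
`y² ∼ π_sam(·|x)` independently, and `o ∼ Ber(ℙ_{r⋆}(y¹ ≻ y² | x))`. -/
def roundLaw (ρ : Measure X) (rstar : X → Y → ℝ) (π πsam : Policy X Y) : Measure (Sample X Y) :=
  ((ρ ⊗ₘ (π.kernel ×ₖ πsam.kernel)).withDensity
      (fun p => ENNReal.ofReal (pref rstar p.1 p.2.1 p.2.2))).map (fun p => (p, true))
  + ((ρ ⊗ₘ (π.kernel ×ₖ πsam.kernel)).withDensity
      (fun p => ENNReal.ofReal (1 - pref rstar p.1 p.2.1 p.2.2))).map (fun p => (p, false))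

/-- A run of `T` rounds of the algorithm with the lightweight bonus, on a probability space
`(Ω, P)`. Rounds are numbered `0, …, T - 1`. In round `t` the policy `π t`, determined by the past
`ℱ t`, generates the comparison `z t`, whose conditional law given `ℱ t` is `roundLaw (π t)`.
The first policy is the reference policy, and each later one maximizes the objective over the
policy class on all the comparisons collected so far (ties broken in any way). -/
structure IsRun {Ω : Type*} [MeasurableSpace Ω] (P : Measure Ω) (ℱ : Filtration ℕ ‹_›) (T : ℕ)
    (ρ : Measure X) (β α γ : ℝ) (rstar : X → Y → ℝ) (πref πsam : Policy X Y)
    (Pi : Set (Policy X Y)) (π : ℕ → Ω → Policy X Y) (z : ℕ → Ω → Sample X Y) : Prop where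
  init : ∀ ω, π 0 ω = πref
  mem_class : ∀ t, t + 1 < T → ∀ ω, π (t + 1) ω ∈ Pi
  isMax : ∀ t, t + 1 < T → ∀ ω, ∀ π' ∈ Pi,
    objective ρ β α γ πref πsam Pi π' (fun s => z s ω) (t + 1)
      ≤ objective ρ β α γ πref πsam Pi (π (t + 1) ω) (fun s => z s ω) (t + 1)
  predictable : ∀ t < T, ∀ p : Policy X Y, MeasurableSet[ℱ t] {ω | π t ω = p}
  adapted : ∀ t < T, Measurable[ℱ (t + 1)] (z t)
  condLaw : ∀ t < T, ∀ S : Set Ω, MeasurableSet[ℱ t] S → ∀ A : Set (Sample X Y), MeasurableSet A →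
    P (S ∩ z t ⁻¹' A) = ∫⁻ ω in S, roundLaw ρ rstar (π t ω) πsam A ∂P

/-- The preference-based regret
`∑ₜ 𝔼_{x ∼ ρ, (y⋆, y, y') ∼ π⋆ ⊗ πₜ ⊗ π_sam(·|x)} [ℙ⋆(y⋆ ≻ y' | x) - ℙ⋆(y ≻ y' | x)]`
of the policies `π 0, …, π (T - 1)`. -/
def prefRegret (ρ : Measure X) (rstar : X → Y → ℝ) (πstar πsam : Policy X Y)
    (π : ℕ → Policy X Y) (T : ℕ) : ℝ :=
  ∑ t ∈ Finset.range T, ∫ x, ∫ ystar, ∫ y, ∫ y',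
    (pref rstar x ystar y' - pref rstar x y y')
      ∂(πsam.at x) ∂((π t).at x) ∂(πstar.at x) ∂ρ

end

end POPO

end

/-! The regret of a round is split by optimism, and the estimation error is summed by an elliptical
potential whose weights are the derivative of the sigmoid.

By Gibbs' variational principle the maximizer `π(r)` is, on almost every prompt, `π_ref` tilted by
`exp (r / β)`. Hence `β log (π(r) / π_ref)` is `r` minus a soft value `V_r` that depends only on the
prompt. Two things follow. The DPO loss of `π(r)` is almost surely the negative Bradley–Terry
log-likelihood of `r` (`IsRun.ae_dpoLoss_eq`). The bonus of `π(r)` is the mean of `σ(V_r(x) -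
r(x,y'))`, and `V_r` falls short of `sup_y r` by at most `β` times a KL divergence, on average over
prompts. Replacing rewards by soft values therefore bounds a round's regret by two such gaps, a
difference of bonuses and the error of the preference model on the data law (`roundRegret_le`).

Half the log-likelihood ratio has a Bhattacharyya coefficient as its exponential moment. Ville's
inequality and a union bound then give, uniformly in `r` and in time, that half the log-likelihood
excess plus the accumulated Hellinger gap is at most `L = log (|R| / δ)`
(`IsRun.measure_exists_logLik_gt_le`). So `π(r⋆)` passes the truncation test with `γ = 2L`. The
chosen policy then loses at most `γ / α` in bonus, and the past Hellinger gap of its reward is at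
most `2L`.

The Hellinger gap dominates the squared reward error, truncated at `1` and weighted by `σ'` at the
true reward difference. The decoupling theorem `sum_integral_le_of_decoupling` carries this control
of past laws over to the present one. Features of small leverage give the `√T` term. Features of
large leverage are charged at the price `1 / min σ'`, which is why `exp Rmax` appears only in the
term logarithmic in `T`. -/

namespace POPO

/-! ### Sigmoid inequalities and the Hellinger distance between Bernoulli laws. -/

section Sigmoid

/-- The Bhattacharyya coefficient of the Bernoulli laws with parameters `σ a` and `σ b`. -/
noncomputable def affinity (a b : ℝ) : ℝ :=
  √(Real.sigmoid a * Real.sigmoid b) + √((1 - Real.sigmoid a) * (1 - Real.sigmoid b))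

/-- Exact form of the increment: it factors through the ratio of odds, so estimates on `exp` give
upper and lower bounds on it. -/
lemma sigmoid_sub (a b : ℝ) :
    Real.sigmoid a - Real.sigmoid b
      = Real.sigmoid a * (1 - Real.sigmoid b) * (1 - Real.exp (-(a - b))) := by
  have ha : Real.exp (-a) = Real.exp (-(a - b)) * Real.exp (-b) := by
    rw [← Real.exp_add]; ring_nf
  have h1 : 0 < 1 + Real.exp (-b) := by positivity
  have h2 : 0 < 1 + Real.exp (-a) := by positivity
  have h3 : 0 < 1 + Real.exp (-(a - b)) * Real.exp (-b) := by positivity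
  rw [Real.sigmoid_def, Real.sigmoid_def, ha]
  field_simp
  ring

lemma abs_sigmoid_sub_le (a b : ℝ) : |Real.sigmoid a - Real.sigmoid b| ≤ |a - b| := by
  wlog h : b ≤ a generalizing a b
  · rw [abs_sub_comm, abs_sub_comm a b]
    exact this b a (le_of_not_ge h)
  have h1 := Real.sigmoid_le h
  rw [abs_of_nonneg (by linarith), abs_of_nonneg (by linarith), sigmoid_sub]
  have h2 := Real.add_one_le_exp (-(a - b))
  have h3 : Real.exp (-(a - b)) ≤ 1 := Real.exp_le_one_iff.2 (by linarith)
  have h4 : Real.sigmoid a * (1 - Real.sigmoid b) ≤ 1 := by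
    nlinarith [Real.sigmoid_pos a, Real.sigmoid_pos b, Real.sigmoid_le_one a,
      Real.sigmoid_le_one b]
  have h5 : 0 ≤ Real.sigmoid a * (1 - Real.sigmoid b) :=
    mul_nonneg (Real.sigmoid_nonneg a) (by linarith [Real.sigmoid_le_one b])
  nlinarith

/-- The derivative of the sigmoid. -/
noncomputable def dsigmoid (b : ℝ) : ℝ := Real.sigmoid b * (1 - Real.sigmoid b)

lemma dsigmoid_pos (b : ℝ) : 0 < dsigmoid b :=
  mul_pos (Real.sigmoid_pos b) (by linarith [Real.sigmoid_lt_one b])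

lemma dsigmoid_le (b : ℝ) : dsigmoid b ≤ 1 / 4 := by
  unfold dsigmoid; nlinarith [sq_nonneg (Real.sigmoid b - 1 / 2)]

lemma dsigmoid_neg (b : ℝ) : dsigmoid (-b) = dsigmoid b := by
  unfold dsigmoid; rw [Real.sigmoid_neg]; ring

/-- By symmetry `b ≥ 0`; then `σ'(b) = σ(b)² exp (-b)` with `σ(b) ≥ 1/2`. This is the only source of
the factor `exp Rmax` in the regret. -/
lemma exp_neg_le_dsigmoid {b R : ℝ} (h : |b| ≤ R) : Real.exp (-R) / 4 ≤ dsigmoid b := by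
  wlog hb : 0 ≤ b generalizing b
  · rw [← dsigmoid_neg]
    exact this (by rwa [abs_neg]) (by linarith)
  rw [abs_of_nonneg hb] at h
  have h1 : 1 / 2 ≤ Real.sigmoid b := by
    have := Real.sigmoid_le hb
    rw [Real.sigmoid_zero] at this; linarith
  have h2 : Real.exp (-R) ≤ Real.exp (-b) := Real.exp_le_exp.2 (by linarith)
  have h3 := Real.sigmoid_mul_rexp_neg b
  rw [Real.sigmoid_neg] at h3
  unfold dsigmoid
  rw [← h3]
  have h4 := Real.exp_pos (-b)
  have : 1 / 4 ≤ Real.sigmoid b * Real.sigmoid b := by nlinarith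
  nlinarith

/-- For close arguments the Lipschitz constant can be taken proportional to `σ'(b)`, because `exp x
- 1 ≤ 2x` on `[0, 1]`. The weight so gained cancels the weight in the information bound. -/
lemma abs_sigmoid_sub_le_dsigmoid {a b : ℝ} (h : |a - b| ≤ 1) :
    |Real.sigmoid a - Real.sigmoid b| ≤ 2 * dsigmoid b * |a - b| := by
  wlog hab : b ≤ a generalizing a b
  · have := @this (-a) (-b) (by rwa [neg_sub_neg, abs_sub_comm]) (by linarith)
    rw [dsigmoid_neg, Real.sigmoid_neg, Real.sigmoid_neg] at this
    rw [abs_sub_comm, abs_sub_comm a b]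
    convert this using 2 <;> ring_nf
  have h1 := Real.sigmoid_le hab
  rw [abs_of_nonneg (by linarith : 0 ≤ a - b)] at h ⊢
  rw [abs_of_nonneg (by linarith)]
  have h2 := sigmoid_sub b a
  have h3 := Real.abs_exp_sub_one_le (x := a - b) (by rwa [abs_of_nonneg (by linarith)])
  rw [abs_of_nonneg (by linarith : 0 ≤ a - b)] at h3
  have h4 := (abs_le.1 h3).2
  rw [neg_sub] at h2
  have h5 : Real.exp (a - b) ≥ 1 := Real.one_le_exp (by linarith)
  have h6 := Real.sigmoid_pos b
  have h7 := Real.sigmoid_lt_one a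
  unfold dsigmoid
  calc Real.sigmoid a - Real.sigmoid b
      = Real.sigmoid b * (1 - Real.sigmoid a) * (Real.exp (a - b) - 1) := by linarith
    _ ≤ Real.sigmoid b * (1 - Real.sigmoid b) * (2 * (a - b)) := by
        have : 0 ≤ Real.sigmoid b * (1 - Real.sigmoid b) := (dsigmoid_pos b).le
        gcongr
    _ = _ := by ring

lemma sq_sub_div_le {u v : ℝ} (hu : 0 ≤ u) (huv : u ≤ v) (hv : 0 < v) :
    (v - u) ^ 2 / (4 * v) ≤ (√v - √u) ^ 2 := by
  rw [div_le_iff₀ (by positivity)]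
  have h1 := Real.sq_sqrt hu
  have h2 := Real.sq_sqrt hv.le
  have h3 := Real.sqrt_le_sqrt huv
  have h4 := Real.sqrt_nonneg u
  have h5 : (√v + √u) ^ 2 ≤ 4 * v := by nlinarith
  have h6 : (v - u) ^ 2 = (√v - √u) ^ 2 * (√v + √u) ^ 2 := by
    rw [← h1, ← h2]; simp only [Real.sqrt_sq h4, Real.sqrt_sq (Real.sqrt_nonneg v)]; ring
  rw [h6]
  gcongr

lemma two_mul_one_sub_affinity (a b : ℝ) :
    2 * (1 - affinity a b) = (√(Real.sigmoid a) - √(Real.sigmoid b)) ^ 2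
      + (√(1 - Real.sigmoid a) - √(1 - Real.sigmoid b)) ^ 2 := by
  have ha := Real.sigmoid_nonneg a
  have hb := Real.sigmoid_nonneg b
  have ha' : 0 ≤ 1 - Real.sigmoid a := by linarith [Real.sigmoid_le_one a]
  have hb' : 0 ≤ 1 - Real.sigmoid b := by linarith [Real.sigmoid_le_one b]
  unfold affinity
  rw [Real.sqrt_mul ha, Real.sqrt_mul ha']
  nlinarith [Real.sq_sqrt ha, Real.sq_sqrt hb, Real.sq_sqrt ha', Real.sq_sqrt hb']

lemma affinity_neg (a b : ℝ) : affinity (-a) (-b) = affinity a b := by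
  unfold affinity; rw [Real.sigmoid_neg, Real.sigmoid_neg, add_comm]; simp

lemma affinity_nonneg (a b : ℝ) : 0 ≤ affinity a b := by unfold affinity; positivity

lemma affinity_le_one (a b : ℝ) : affinity a b ≤ 1 := by
  have := two_mul_one_sub_affinity a b
  nlinarith [sq_nonneg (√(Real.sigmoid a) - √(Real.sigmoid b)),
    sq_nonneg (√(1 - Real.sigmoid a) - √(1 - Real.sigmoid b))]

/-- Twice `1 - affinity` is a sum of two squared differences of square roots, one per label. A
single one of them suffices: that of the label less likely under `b`, whose probability is
comparable to `σ'(b)`. -/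
lemma dsigmoid_mul_min_le_one_sub_affinity (a b : ℝ) :
    dsigmoid b * min 1 ((a - b) ^ 2) ≤ 128 * (1 - affinity a b) := by
  wlog hab : b ≤ a generalizing a b
  · have := this (-a) (-b) (by linarith)
    rw [dsigmoid_neg, affinity_neg] at this
    convert this using 3
    ring
  set p := Real.sigmoid a with hp
  set q := Real.sigmoid b with hq
  have hp0 : 0 < p := Real.sigmoid_pos a
  have hq0 : 0 < q := Real.sigmoid_pos b
  have hp1 : p < 1 := Real.sigmoid_lt_one a
  have hq1 : q < 1 := Real.sigmoid_lt_one b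
  have hqp : q ≤ p := Real.sigmoid_le hab
  set m := min 1 (a - b) with hm
  have hm0 : 0 ≤ m := le_min zero_le_one (by linarith)
  have hm1 : m ≤ 1 := min_le_left _ _
  have hmm : min 1 ((a - b) ^ 2) = m ^ 2 := by
    rcases le_total 1 (a - b) with h | h
    · rw [hm, min_eq_left h, min_eq_left (by nlinarith)]; norm_num
    · rw [hm, min_eq_right h, min_eq_right (by nlinarith)]
  have hexp : m / 2 ≤ 1 - Real.exp (-(a - b)) := by
    have h1 : Real.exp (-(a - b)) ≤ Real.exp (-m) :=
      Real.exp_le_exp.2 (by linarith [min_le_right 1 (a - b)])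
    have h2 : Real.exp (-m) ≤ 1 / (1 + m) := by
      rw [Real.exp_neg, ← one_div]
      exact one_div_le_one_div_of_le (by linarith) (by linarith [Real.add_one_le_exp m])
    have h3 : 1 / (1 + m) ≤ 1 - m / 2 := by
      rw [div_le_iff₀ (by linarith)]; nlinarith
    linarith
  have hdiff : p * (1 - q) * (m / 2) ≤ p - q := by
    rw [hp, hq, sigmoid_sub]
    exact mul_le_mul_of_nonneg_left hexp (mul_nonneg hp0.le (by linarith))
  have haff := two_mul_one_sub_affinity a b
  rw [← hp, ← hq] at haff
  unfold dsigmoid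
  rw [← hq, hmm]
  -- For `q ≤ 1/2` the increment is at least `p m / 4` and the success probabilities are used;
  -- otherwise `p ≥ 1/2`, the increment is at least `(1 - q) m / 4`, and the failure probabilities
  -- are used.
  rcases le_total q (1 / 2) with h | h
  · have h1 := sq_sub_div_le hq0.le hqp hp0
    have h2 : p * (m / 4) ≤ p - q := by
      refine le_trans ?_ hdiff
      have : 0 ≤ p * m := by positivity
      nlinarith
    have h3 : p * m ^ 2 / 64 ≤ (p - q) ^ 2 / (4 * p) := by
      rw [le_div_iff₀ (by positivity)]
      calc p * m ^ 2 / 64 * (4 * p) = (p * (m / 4)) ^ 2 := by ring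
        _ ≤ _ := by gcongr
    have h4 := sq_nonneg (√(1 - p) - √(1 - q))
    have h5 : q * (1 - q) * m ^ 2 ≤ p * m ^ 2 := by
      gcongr; nlinarith
    linarith
  · have h1 := sq_sub_div_le (u := 1 - p) (v := 1 - q) (by linarith) (by linarith) (by linarith)
    have h2 : (1 - q) * (m / 4) ≤ p - q := by
      refine le_trans ?_ hdiff
      have : 0 ≤ (1 - q) * m := mul_nonneg (by linarith) hm0
      nlinarith
    have h3 : (1 - q) * m ^ 2 / 64 ≤ (1 - q - (1 - p)) ^ 2 / (4 * (1 - q)) := by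
      rw [le_div_iff₀ (by linarith)]
      calc (1 - q) * m ^ 2 / 64 * (4 * (1 - q)) = ((1 - q) * (m / 4)) ^ 2 := by ring
        _ ≤ (p - q) ^ 2 := by
            have : 0 ≤ (1 - q) * (m / 4) := mul_nonneg (by linarith) (by linarith)
            gcongr
        _ = _ := by ring
    have h4 := sq_nonneg (√p - √q)
    have h5 : q * (1 - q) * m ^ 2 ≤ (1 - q) * m ^ 2 := by
      gcongr; nlinarith
    have h6 : (√(1 - q) - √(1 - p)) ^ 2 = (√(1 - p) - √(1 - q)) ^ 2 := by ring
    linarith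

lemma continuous_affinity : Continuous fun p : ℝ × ℝ => affinity p.1 p.2 := by
  have h : Continuous Real.sigmoid := continuous_sigmoid
  unfold affinity
  fun_prop

end Sigmoid

/-! ### The elliptical potential lemma for positive semidefinite increments. -/

section EllipticalPotential

open Matrix
open scoped MatrixOrder ComplexOrder

variable {n : Type*} [Fintype n] [DecidableEq n]

lemma one_add_sum_le_prod {ι : Type*} (s : Finset ι) (f : ι → ℝ) (hf : ∀ i, 0 ≤ f i) :
    1 + ∑ i ∈ s, f i ≤ ∏ i ∈ s, (1 + f i) := by
  classical
  induction s using Finset.induction_on with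
  | empty => simp
  | insert i s hi ih =>
    rw [Finset.sum_insert hi, Finset.prod_insert hi]
    nlinarith [hf i, Finset.sum_nonneg fun j (_ : j ∈ s) => hf j]

/-- In terms of eigenvalues this is `1 + ∑ λ ≤ ∏ (1 + λ)`; the product is read off the
characteristic polynomial at `-1`. -/
lemma one_add_trace_le_det {M : Matrix n n ℝ} (hM : M.PosSemidef) :
    1 + M.trace ≤ (1 + M).det := by
  have h1 := hM.isHermitian.charpoly_eq
  have h2 := congrArg (Polynomial.eval (-1)) h1
  rw [Matrix.eval_charpoly] at h2
  simp only [Polynomial.eval_prod, Polynomial.eval_sub, Polynomial.eval_X,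
    Polynomial.eval_C] at h2
  have h3 : Matrix.scalar n (-1 : ℝ) - M = -(1 + M) := by
    rw [map_neg, map_one]; abel
  rw [h3, Matrix.det_neg] at h2
  have h4 : ∏ i, ((-1 : ℝ) - (hM.isHermitian.eigenvalues i : ℝ))
      = (-1) ^ Fintype.card n * ∏ i, (1 + hM.isHermitian.eigenvalues i) := by
    rw [← Finset.card_univ, ← Finset.prod_const, ← Finset.prod_mul_distrib]
    exact Finset.prod_congr rfl fun i _ => by ring
  have h5 : (1 + M).det = ∏ i, (1 + hM.isHermitian.eigenvalues i) := by
    have h6 : ((-1 : ℝ) ^ Fintype.card n) ≠ 0 := by positivity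
    refine mul_left_cancel₀ h6 ?_
    rw [h2, ← h4]; rfl
  rw [h5, hM.isHermitian.trace_eq_sum_eigenvalues]
  exact one_add_sum_le_prod _ _ fun i => hM.eigenvalues_nonneg i

/-- Factoring `V = Bᴴ B` and conjugating by `B⁻¹` reduces to the case `V = 1`. -/
lemma det_mul_one_add_trace_le_det_add {V A : Matrix n n ℝ} (hV : V.PosDef)
    (hA : A.PosSemidef) : V.det * (1 + (V⁻¹ * A).trace) ≤ (V + A).det := by
  obtain ⟨B, hB, rfl⟩ : ∃ B : Matrix n n ℝ, IsUnit B ∧ V = Bᴴ * B := by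
    obtain ⟨B, hB⟩ := CStarAlgebra.nonneg_iff_eq_star_mul_self.1 hV.posSemidef.nonneg
    refine ⟨B, ?_, hB⟩
    have := hV.isUnit
    rw [hB] at this
    exact isUnit_of_mul_isUnit_right this
  have hBd : IsUnit B.det := (Matrix.isUnit_iff_isUnit_det B).1 hB
  have hBd' : IsUnit Bᴴ.det := by rw [Matrix.det_conjTranspose]; exact hBd.star
  set M := (B⁻¹)ᴴ * A * B⁻¹ with hMdef
  have hM : M.PosSemidef := hA.conjTranspose_mul_mul_same _
  have h1 : Bᴴ * B + A = Bᴴ * (1 + M) * B := by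
    rw [hMdef, Matrix.conjTranspose_nonsing_inv, Matrix.mul_add, Matrix.add_mul, Matrix.mul_one]
    congr 1
    simp only [Matrix.mul_assoc]
    rw [Matrix.nonsing_inv_mul _ hBd, Matrix.mul_one, ← Matrix.mul_assoc,
      Matrix.mul_nonsing_inv _ hBd', Matrix.one_mul]
  have h2 : ((Bᴴ * B)⁻¹ * A).trace = M.trace := by
    rw [Matrix.mul_inv_rev, hMdef, Matrix.conjTranspose_nonsing_inv, Matrix.trace_mul_comm _ B⁻¹,
      Matrix.mul_assoc]
  rw [h1, h2, Matrix.det_mul, Matrix.det_mul, Matrix.det_mul]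
  have h3 := one_add_trace_le_det hM
  have h4 : 0 ≤ Bᴴ.det * B.det := by
    rw [Matrix.det_conjTranspose]; exact mul_self_nonneg _
  nlinarith

/-- The arithmetic–geometric mean inequality for the eigenvalues. -/
lemma det_le_trace_div_pow [Nonempty n] {V : Matrix n n ℝ} (hV : V.PosSemidef) :
    V.det ≤ (V.trace / Fintype.card n) ^ Fintype.card n := by
  have hd : (0 : ℝ) < Fintype.card n := by exact_mod_cast Fintype.card_pos
  set l := hV.isHermitian.eigenvalues
  have hl : ∀ i, 0 ≤ l i := hV.eigenvalues_nonneg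
  have h := Real.geom_mean_le_arith_mean_weighted Finset.univ
    (fun _ : n => (Fintype.card n : ℝ)⁻¹) l (fun _ _ => by positivity)
    (by simp [hd.ne']) (fun i _ => hl i)
  have h1 : V.det = (∏ i, l i ^ (Fintype.card n : ℝ)⁻¹) ^ Fintype.card n := by
    rw [← Finset.prod_pow, hV.isHermitian.det_eq_prod_eigenvalues]
    refine Finset.prod_congr rfl fun i _ => ?_
    rw [← Real.rpow_natCast, ← Real.rpow_mul (hl i), inv_mul_cancel₀ hd.ne', Real.rpow_one]
    rfl
  have h2 : V.trace / Fintype.card n = ∑ i, (Fintype.card n : ℝ)⁻¹ * l i := by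
    rw [hV.isHermitian.trace_eq_sum_eigenvalues, ← Finset.mul_sum, div_eq_inv_mul]
    rfl
  rw [h1, h2]
  exact pow_le_pow_left₀ (Finset.prod_nonneg fun i _ => Real.rpow_nonneg (hl i) _) h _

/-- The elliptical potential lemma, for matrix increments. -/
lemma sum_trace_inv_mul_le [Nonempty n] (V A : ℕ → Matrix n n ℝ) {c : ℝ} (hc : 0 < c)
    (hV0 : V 0 = c • 1) (hV : ∀ t, V (t + 1) = V t + A t) (hA : ∀ t, (A t).PosSemidef)
    (htr : ∀ t, (A t).trace ≤ 1) (hle : ∀ t, ((V t)⁻¹ * A t).trace ≤ 1) (T : ℕ) :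
    ∑ t ∈ Finset.range T, ((V t)⁻¹ * A t).trace
      ≤ 2 * (Fintype.card n * Real.log (1 + T / (Fintype.card n * c))) := by
  have hd : (0 : ℝ) < Fintype.card n := by exact_mod_cast Fintype.card_pos
  have hpos : ∀ t, (V t).PosDef := by
    intro t
    induction t with
    | zero => rw [hV0]; exact Matrix.PosDef.one.smul hc
    | succ t ih => rw [hV]; exact ih.add_posSemidef (hA t)
  have hnn : ∀ t, 0 ≤ ((V t)⁻¹ * A t).trace := by
    intro t
    obtain ⟨B, hB⟩ := CStarAlgebra.nonneg_iff_eq_star_mul_self.1 (hA t).nonneg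
    rw [hB, ← Matrix.mul_assoc, Matrix.trace_mul_comm, ← Matrix.mul_assoc]
    exact ((hpos t).inv.posSemidef.mul_mul_conjTranspose_same B).trace_nonneg
  -- `log det` telescopes. The factor `1/2` comes from `τ / 2 ≤ log (1 + τ)`, valid since `τ ≤ 1`.
  have hlog : ∀ T, ∑ t ∈ Finset.range T, ((V t)⁻¹ * A t).trace / 2
      ≤ Real.log (V T).det - Real.log (V 0).det := by
    intro T
    induction T with
    | zero => simp
    | succ T ih =>
      rw [Finset.sum_range_succ]
      have h1 := det_mul_one_add_trace_le_det_add (hpos T) (hA T)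
      rw [← hV] at h1
      have h2 := hnn T
      have h3 := hle T
      set τ := ((V T)⁻¹ * A T).trace
      have h4 := Real.log_le_log (mul_pos (hpos T).det_pos (by linarith)) h1
      rw [Real.log_mul (hpos T).det_pos.ne' (by linarith)] at h4
      have h5 : τ / 2 ≤ Real.log (1 + τ) := by
        have h6 := Real.one_sub_inv_le_log_of_pos (by linarith : 0 < 1 + τ)
        have h7 : τ / 2 ≤ 1 - (1 + τ)⁻¹ := by
          have h8 : 1 - (1 + τ)⁻¹ = τ / (1 + τ) := by field_simp; ring
          rw [h8, div_le_div_iff₀ (by norm_num) (by linarith)]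
          nlinarith
        linarith
      linarith
  have htrV : ∀ T : ℕ, (V T).trace ≤ Fintype.card n * c + T := by
    intro T
    induction T with
    | zero => rw [hV0]; simp [mul_comm]
    | succ T ih =>
      rw [hV, Matrix.trace_add]; push_cast; linarith [htr T]
  have h1 := hlog T
  rw [← Finset.sum_div] at h1
  have h2 : Real.log (V 0).det = Fintype.card n * Real.log c := by
    rw [hV0, Matrix.det_smul, Matrix.det_one, mul_one, Real.log_pow]
  have h3 : Real.log (V T).det
      ≤ Fintype.card n * Real.log ((Fintype.card n * c + T) / Fintype.card n) := by
    rw [← Real.log_pow]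
    refine Real.log_le_log (hpos T).det_pos ((det_le_trace_div_pow (hpos T).posSemidef).trans ?_)
    have := (hpos T).posSemidef.trace_nonneg
    have h4 := htrV T
    gcongr
  have h5 : (Fintype.card n * c + T) / Fintype.card n
      = c * (1 + T / (Fintype.card n * c)) := by field_simp
  rw [h5, Real.log_mul hc.ne' (by positivity)] at h3
  nlinarith

/-- Cauchy–Schwarz for the dual norms of `V` and `V⁻¹`: the form `V` at `v - s V⁻¹ u` is a
nonnegative quadratic in `s`, so its discriminant is nonpositive. -/
lemma sq_dotProduct_le {V : Matrix n n ℝ} (hV : V.PosDef) (u v : n → ℝ) :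
    (u ⬝ᵥ v) ^ 2 ≤ (u ⬝ᵥ V⁻¹ *ᵥ u) * (v ⬝ᵥ V *ᵥ v) := by
  have hdet : IsUnit V.det := (Matrix.isUnit_iff_isUnit_det V).1 hV.isUnit
  have hsymm : Vᵀ = V := hV.isHermitian
  have h : ∀ s : ℝ, 0 ≤ (u ⬝ᵥ V⁻¹ *ᵥ u) * (s * s) + (-2 * (u ⬝ᵥ v)) * s + v ⬝ᵥ V *ᵥ v := by
    intro s
    have h1 := hV.posSemidef.dotProduct_mulVec_nonneg (v - s • V⁻¹ *ᵥ u)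
    have h2 : V *ᵥ V⁻¹ *ᵥ u = u := by
      rw [Matrix.mulVec_mulVec, Matrix.mul_nonsing_inv _ hdet, Matrix.one_mulVec]
    have h3 : V⁻¹ *ᵥ u ⬝ᵥ V *ᵥ v = u ⬝ᵥ v := by
      rw [Matrix.dotProduct_mulVec, ← Matrix.mulVec_transpose, hsymm, h2]
    simp only [star_trivial, Matrix.mulVec_sub, Matrix.mulVec_smul, h2, dotProduct_sub,
      sub_dotProduct, dotProduct_smul, smul_dotProduct, h3, smul_eq_mul] at h1
    rw [dotProduct_comm v u, dotProduct_comm (V⁻¹ *ᵥ u) u] at h1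
    linarith
  have := discrim_le_zero h
  unfold discrim at this
  nlinarith

end EllipticalPotential

/-! ### Decoupling: from bounded past information to small present errors. -/

section Decoupling

open Matrix

lemma abs_apply_le_one {n : Type*} [Fintype n] {u : n → ℝ} (hu : u ⬝ᵥ u ≤ 1) (i : n) :
    |u i| ≤ 1 := by
  have h : u i * u i ≤ u ⬝ᵥ u :=
    Finset.single_le_sum (f := fun i => u i * u i) (fun j _ => mul_self_nonneg _)
      (Finset.mem_univ i)
  exact abs_le_one_iff_mul_self_le_one.2 (h.trans hu)

variable {n Z : Type*} [Fintype n] [DecidableEq n] [MeasurableSpace Z]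

/-- The size of a feature vector relative to a design matrix. -/
noncomputable def leverage (V : Matrix n n ℝ) (u : n → ℝ) : ℝ := √(u ⬝ᵥ V⁻¹ *ᵥ u)

/-- The factor that shrinks a feature vector to leverage at most `κ`. -/
noncomputable def shrink (κ : ℝ) (V : Matrix n n ℝ) (u : n → ℝ) : ℝ := κ / max κ (leverage V u)

/-- The expected Gram matrix of the shrunk features with weight `g`. -/
noncomputable def gram (κ : ℝ) (g : Z → ℝ) (ψ : Z → n → ℝ) (V : Matrix n n ℝ)
    (μ : Measure Z) : Matrix n n ℝ :=
  Matrix.of fun i j => ∫ z, g z * shrink κ V (ψ z) ^ 2 * (ψ z i * ψ z j) ∂μ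

/-- The design matrices: regularized sums of the expected Gram matrices. -/
noncomputable def design (c κ : ℝ) (g : Z → ℝ) (ψ : Z → n → ℝ) (μ : ℕ → Measure Z) :
    ℕ → Matrix n n ℝ
  | 0 => c • 1
  | t + 1 => design c κ g ψ μ t + gram κ g ψ (design c κ g ψ μ t) (μ t)

lemma leverage_nonneg (V : Matrix n n ℝ) (u : n → ℝ) : 0 ≤ leverage V u := Real.sqrt_nonneg _

lemma sq_leverage {V : Matrix n n ℝ} (hV : V.PosDef) (u : n → ℝ) :
    leverage V u ^ 2 = u ⬝ᵥ V⁻¹ *ᵥ u := by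
  unfold leverage
  rw [Real.sq_sqrt]
  simpa using hV.inv.posSemidef.dotProduct_mulVec_nonneg u

lemma shrink_pos {κ : ℝ} (hκ : 0 < κ) (V : Matrix n n ℝ) (u : n → ℝ) : 0 < shrink κ V u :=
  div_pos hκ (lt_max_of_lt_left hκ)

lemma shrink_le_one {κ : ℝ} (hκ : 0 < κ) (V : Matrix n n ℝ) (u : n → ℝ) : shrink κ V u ≤ 1 :=
  div_le_one_of_le₀ (le_max_left _ _) (hκ.le.trans (le_max_left _ _))

lemma shrink_mul_leverage_le {κ : ℝ} (hκ : 0 < κ) (V : Matrix n n ℝ) (u : n → ℝ) :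
    shrink κ V u * leverage V u ≤ κ := by
  unfold shrink
  rw [div_mul_eq_mul_div, div_le_iff₀ (lt_max_of_lt_left hκ)]
  exact mul_le_mul_of_nonneg_left (le_max_right _ _) hκ.le

lemma measurable_leverage (V : Matrix n n ℝ) : Measurable (leverage V) := by
  unfold leverage
  have : Continuous fun u : n → ℝ => u ⬝ᵥ V⁻¹ *ᵥ u := by fun_prop
  exact this.measurable.sqrt

lemma measurable_shrink (κ : ℝ) (V : Matrix n n ℝ) : Measurable (shrink κ V) :=
  measurable_const.div (measurable_const.max (measurable_leverage V))

variable {κ c : ℝ} {g : Z → ℝ} {ψ : Z → n → ℝ}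

lemma integrable_of_bounded {μ : Measure Z} [IsFiniteMeasure μ] {f : Z → ℝ} (hf : Measurable f)
    (C : ℝ) (hC : ∀ z, |f z| ≤ C) : Integrable f μ :=
  Integrable.of_bound hf.aestronglyMeasurable C (Filter.Eventually.of_forall hC)

lemma integrable_gram (hκ : 0 < κ) (hg : Measurable g) (hg0 : ∀ z, 0 ≤ g z) (hg1 : ∀ z, g z ≤ 1)
    (hψ : Measurable ψ) (hψ1 : ∀ z, ψ z ⬝ᵥ ψ z ≤ 1) (V : Matrix n n ℝ) (μ : Measure Z)
    [IsFiniteMeasure μ] (i j : n) :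
    Integrable (fun z => g z * shrink κ V (ψ z) ^ 2 * (ψ z i * ψ z j)) μ := by
  have hi : ∀ i, Measurable fun z => ψ z i := fun i => (measurable_pi_apply i).comp hψ
  refine integrable_of_bounded
    ((hg.mul (((measurable_shrink κ V).comp hψ).pow_const 2)).mul ((hi i).mul (hi j))) 1
    fun z => ?_
  have h1 := abs_apply_le_one (hψ1 z) i
  have h2 := abs_apply_le_one (hψ1 z) j
  have h3 : shrink κ V (ψ z) ^ 2 ≤ 1 :=
    pow_le_one₀ (shrink_pos hκ V _).le (shrink_le_one hκ V _)
  rw [abs_mul, abs_mul, abs_mul, abs_of_nonneg (hg0 z), abs_of_nonneg (sq_nonneg _)]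
  exact mul_le_one₀ (mul_le_one₀ (hg1 z) (sq_nonneg _) h3) (by positivity)
    (mul_le_one₀ h1 (abs_nonneg _) h2)

lemma trace_mul_gram (hκ : 0 < κ) (hg : Measurable g) (hg0 : ∀ z, 0 ≤ g z) (hg1 : ∀ z, g z ≤ 1)
    (hψ : Measurable ψ) (hψ1 : ∀ z, ψ z ⬝ᵥ ψ z ≤ 1) (V W : Matrix n n ℝ) (μ : Measure Z)
    [IsFiniteMeasure μ] :
    Integrable (fun z => g z * shrink κ V (ψ z) ^ 2 * (ψ z ⬝ᵥ W *ᵥ ψ z)) μ ∧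
    (W * gram κ g ψ V μ).trace
      = ∫ z, g z * shrink κ V (ψ z) ^ 2 * (ψ z ⬝ᵥ W *ᵥ ψ z) ∂μ := by
  have hint := fun i j => (integrable_gram hκ hg hg0 hg1 hψ hψ1 V μ i j).const_mul (W j i)
  have h1 : ∀ z, g z * shrink κ V (ψ z) ^ 2 * (ψ z ⬝ᵥ W *ᵥ ψ z)
      = ∑ j, ∑ i, W j i * (g z * shrink κ V (ψ z) ^ 2 * (ψ z i * ψ z j)) := by
    intro z
    simp only [dotProduct, mulVec, Finset.mul_sum]
    exact Finset.sum_congr rfl fun j _ => Finset.sum_congr rfl fun i _ => by ring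
  simp only [h1]
  refine ⟨integrable_finsetSum _ fun j _ => integrable_finsetSum _ fun i _ => hint i j, ?_⟩
  rw [integral_finsetSum _ fun j _ => integrable_finsetSum _ fun i _ => hint i j]
  simp only [Matrix.trace, Matrix.diag, Matrix.mul_apply]
  refine Finset.sum_congr rfl fun j _ => ?_
  rw [integral_finsetSum _ fun i _ => hint i j]
  refine Finset.sum_congr rfl fun i _ => ?_
  rw [integral_const_mul]
  rfl

lemma dotProduct_gram_mulVec (hκ : 0 < κ) (hg : Measurable g) (hg0 : ∀ z, 0 ≤ g z)
    (hg1 : ∀ z, g z ≤ 1)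
    (hψ : Measurable ψ) (hψ1 : ∀ z, ψ z ⬝ᵥ ψ z ≤ 1) (V : Matrix n n ℝ) (μ : Measure Z)
    [IsFiniteMeasure μ] (v : n → ℝ) :
    Integrable (fun z => g z * shrink κ V (ψ z) ^ 2 * (ψ z ⬝ᵥ v) ^ 2) μ ∧
    v ⬝ᵥ gram κ g ψ V μ *ᵥ v = ∫ z, g z * shrink κ V (ψ z) ^ 2 * (ψ z ⬝ᵥ v) ^ 2 ∂μ := by
  have h := trace_mul_gram hκ hg hg0 hg1 hψ hψ1 V (vecMulVec v v) μ
  have h1 : ∀ u : n → ℝ, u ⬝ᵥ vecMulVec v v *ᵥ u = (u ⬝ᵥ v) ^ 2 := by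
    intro u
    rw [vecMulVec_mulVec, sq, dotProduct_comm v u]
    simp [dotProduct_smul]
  simp only [h1] at h
  refine ⟨h.1, ?_⟩
  rw [← h.2, vecMulVec_mul, trace_vecMulVec]
  exact (dotProduct_mulVec _ _ _).trans (dotProduct_comm _ _)

lemma posSemidef_gram (hκ : 0 < κ) (hg : Measurable g) (hg0 : ∀ z, 0 ≤ g z) (hg1 : ∀ z, g z ≤ 1)
    (hψ : Measurable ψ) (hψ1 : ∀ z, ψ z ⬝ᵥ ψ z ≤ 1) (V : Matrix n n ℝ) (μ : Measure Z)
    [IsFiniteMeasure μ] : (gram κ g ψ V μ).PosSemidef := by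
  refine Matrix.PosSemidef.of_dotProduct_mulVec_nonneg ?_ fun v => ?_
  · ext i j
    simp only [conjTranspose_apply, star_trivial, gram, of_apply]
    exact integral_congr_ae (Filter.Eventually.of_forall fun z => by ring)
  · rw [star_trivial, (dotProduct_gram_mulVec hκ hg hg0 hg1 hψ hψ1 V μ v).2]
    exact integral_nonneg fun z => mul_nonneg (mul_nonneg (hg0 z) (sq_nonneg _)) (sq_nonneg _)

/-- Decoupling: if the weighted truncated squared predictions of `θ t` on the laws before round
`t` sum to at most `B₀`, then the discrepancies `D t` on the laws `μ t` are summable at the rate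
given by the elliptical potential. -/
theorem sum_integral_le_of_decoupling [Nonempty n] (hc : 0 < c) {B K m η : ℝ} (hB : 1 ≤ B)
    (hK : 0 ≤ K) (hm : 0 < m) (hη : 0 < η)
    (hg : Measurable g) (hgm : ∀ z, m ≤ g z) (hg1 : ∀ z, g z ≤ 1)
    (hψ : Measurable ψ) (hψ1 : ∀ z, ψ z ⬝ᵥ ψ z ≤ 1)
    (μ : ℕ → Measure Z) [∀ t, IsProbabilityMeasure (μ t)] (T : ℕ) (θ : ℕ → n → ℝ)
    (hθ : ∀ t < T, c * (θ t ⬝ᵥ θ t)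
      + ∑ s ∈ Finset.range t, ∫ z, g z * min 1 ((ψ z ⬝ᵥ θ t) ^ 2) ∂(μ s) ≤ B)
    (D : ℕ → Z → ℝ) (hD : ∀ t, Measurable (D t)) (hD0 : ∀ t z, 0 ≤ D t z)
    (hD1 : ∀ t z, D t z ≤ 1)
    (hDw : ∀ t z, |ψ z ⬝ᵥ θ t| ≤ 1 → D t z ≤ K * (g z * |ψ z ⬝ᵥ θ t|)) :
    ∑ t ∈ Finset.range T, ∫ z, D t z ∂(μ t)
      ≤ K * √B / 2 * (T * η) + (K * √B / (2 * η) + B / m) *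
        (2 * (Fintype.card n * Real.log (1 + T / (Fintype.card n * c)))) := by
  have hg0 : ∀ z, 0 ≤ g z := fun z => hm.le.trans (hgm z)
  have hsB : 0 < √B := Real.sqrt_pos.2 (by linarith)
  -- If `θᵀ V θ ≤ B`, Cauchy–Schwarz bounds predictions on features of leverage at most `1 / √B` by
  -- `1`. On shrunk features the truncation `min 1` is then inactive, and Gram matrices can account
  -- for the truncated information.
  set κ := (√B)⁻¹ with hκdef
  have hκ : 0 < κ := inv_pos.2 hsB
  have hκ1 : κ ≤ 1 := inv_le_one_of_one_le₀ (Real.one_le_sqrt.2 hB)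
  set V := design c κ g ψ μ with hVdef
  have hA : ∀ t, (gram κ g ψ (V t) (μ t)).PosSemidef := fun t =>
    posSemidef_gram hκ hg hg0 hg1 hψ hψ1 _ _
  have hVs : ∀ t, V (t + 1) = V t + gram κ g ψ (V t) (μ t) := fun t => rfl
  have hpos : ∀ t, (V t).PosDef := by
    intro t
    induction t with
    | zero => exact Matrix.PosDef.one.smul hc
    | succ t ih => rw [hVs]; exact ih.add_posSemidef (hA t)
  have hτ : ∀ t, ((V t)⁻¹ * gram κ g ψ (V t) (μ t)).trace
      = ∫ z, g z * shrink κ (V t) (ψ z) ^ 2 * leverage (V t) (ψ z) ^ 2 ∂(μ t) := by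
    intro t
    simp only [sq_leverage (hpos t)]
    exact (trace_mul_gram hκ hg hg0 hg1 hψ hψ1 (V t) (V t)⁻¹ (μ t)).2
  have hτi : ∀ t, Integrable
      (fun z => g z * shrink κ (V t) (ψ z) ^ 2 * leverage (V t) (ψ z) ^ 2) (μ t) := by
    intro t
    simp only [sq_leverage (hpos t)]
    exact (trace_mul_gram hκ hg hg0 hg1 hψ hψ1 (V t) (V t)⁻¹ (μ t)).1
  have hul : ∀ t z, shrink κ (V t) (ψ z) ^ 2 * leverage (V t) (ψ z) ^ 2 ≤ κ ^ 2 := by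
    intro t z
    rw [← mul_pow]
    exact pow_le_pow_left₀ (mul_nonneg (shrink_pos hκ _ _).le (leverage_nonneg _ _))
      (shrink_mul_leverage_le hκ _ _) 2
  have hpot := sum_trace_inv_mul_le V (fun t => gram κ g ψ (V t) (μ t)) hc rfl hVs hA
    (by
      intro t
      have h := trace_mul_gram hκ hg hg0 hg1 hψ hψ1 (V t) 1 (μ t)
      rw [Matrix.one_mul] at h
      rw [h.2]
      simp only [Matrix.one_mulVec] at h ⊢
      calc _ ≤ ∫ _, (1 : ℝ) ∂(μ t) := by
            refine integral_mono h.1 (integrable_const _) fun z => ?_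
            exact mul_le_one₀ (mul_le_one₀ (hg1 z) (sq_nonneg _)
              (pow_le_one₀ (shrink_pos hκ _ _).le (shrink_le_one hκ _ _)))
              (by simpa using dotProduct_star_self_nonneg (ψ z)) (hψ1 z)
        _ = 1 := by simp)
    (by
      intro t
      rw [hτ]
      calc _ ≤ ∫ _, (1 : ℝ) ∂(μ t) := by
            refine integral_mono (hτi t) (integrable_const _) fun z => ?_
            change g z * _ * _ ≤ 1
            rw [mul_assoc]
            exact mul_le_one₀ (hg1 z) (by positivity)
              ((hul t z).trans (pow_le_one₀ hκ.le hκ1))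
        _ = 1 := by simp) T
  -- Induction on `s`, because the argument feeds itself: the bound `B` on the form of `V s` is what
  -- makes the squared shrunk prediction at most `1` under `μ s`, hence at most the truncated
  -- square, and this gives the bound for `V (s + 1)`.
  have hquad : ∀ t < T, ∀ s ≤ t, θ t ⬝ᵥ V s *ᵥ θ t ≤ c * (θ t ⬝ᵥ θ t)
      + ∑ u ∈ Finset.range s, ∫ z, g z * min 1 ((ψ z ⬝ᵥ θ t) ^ 2) ∂(μ u) := by
    intro t ht s
    induction s with
    | zero =>
      intro _
      have : V 0 = c • 1 := rfl
      rw [this]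
      simp [Matrix.smul_mulVec, dotProduct_smul]
    | succ s ih =>
      intro hs
      have hs' : s ≤ t := by omega
      have ih := ih hs'
      have hle : θ t ⬝ᵥ V s *ᵥ θ t ≤ B := by
        refine ih.trans (le_trans ?_ (hθ t ht))
        gcongr
        · intro i _ _
          exact integral_nonneg fun z =>
            mul_nonneg (hg0 z) (le_min zero_le_one (sq_nonneg _))
      rw [hVs, Matrix.add_mulVec, dotProduct_add, Finset.sum_range_succ, ← add_assoc]
      refine add_le_add ih ?_
      have hd := dotProduct_gram_mulVec hκ hg hg0 hg1 hψ hψ1 (V s) (μ s) (θ t)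
      rw [hd.2]
      have hmeas : Measurable fun z => ψ z ⬝ᵥ θ t := by
        have : Continuous fun u : n → ℝ => u ⬝ᵥ θ t := by fun_prop
        exact this.measurable.comp hψ
      refine integral_mono hd.1 (integrable_of_bounded
        (hg.mul (measurable_const.min (hmeas.pow_const 2))) 1 fun z => ?_) fun z => ?_
      · have h0 : 0 ≤ min 1 ((ψ z ⬝ᵥ θ t) ^ 2) := le_min zero_le_one (sq_nonneg _)
        rw [abs_of_nonneg (mul_nonneg (hg0 z) h0)]
        exact mul_le_one₀ (hg1 z) h0 (min_le_left _ _)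
      · change g z * _ * _ ≤ _
        rw [mul_assoc]
        refine mul_le_mul_of_nonneg_left (le_min ?_ ?_) (hg0 z)
        · calc _ ≤ shrink κ (V s) (ψ z) ^ 2
                * (leverage (V s) (ψ z) ^ 2 * (θ t ⬝ᵥ V s *ᵥ θ t)) := by
                gcongr
                rw [sq_leverage (hpos s)]
                exact sq_dotProduct_le (hpos s) _ _
            _ ≤ shrink κ (V s) (ψ z) ^ 2 * (leverage (V s) (ψ z) ^ 2 * B) := by gcongr
            _ = (shrink κ (V s) (ψ z) ^ 2 * leverage (V s) (ψ z) ^ 2) * B := by ring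
            _ ≤ κ ^ 2 * B := by
                have := hul s z
                gcongr
            _ = 1 := by
                rw [hκdef, inv_pow, Real.sq_sqrt (by linarith)]
                exact inv_mul_cancel₀ (by linarith)
        · have := pow_le_one₀ (n := 2) (shrink_pos hκ (V s) (ψ z)).le (shrink_le_one hκ (V s) (ψ z))
          nlinarith [sq_nonneg (ψ z ⬝ᵥ θ t)]
  have hstep : ∀ t < T, ∫ z, D t z ∂(μ t) ≤ K * √B / 2 * η + (K * √B / (2 * η) + B / m)
      * ((V t)⁻¹ * gram κ g ψ (V t) (μ t)).trace := by
    intro t ht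
    rw [hτ, ← integral_const_mul]
    have hc1 : K * √B / 2 * η = ∫ _, K * √B / 2 * η ∂(μ t) := by simp
    rw [hc1, ← integral_add (integrable_const _) ((hτi t).const_mul _)]
    refine integral_mono (integrable_of_bounded (hD t) 1 fun z => by
      rw [abs_of_nonneg (hD0 t z)]; exact hD1 t z)
      ((integrable_const _).add ((hτi t).const_mul _)) fun z => ?_
    change D t z ≤ K * √B / 2 * η + (K * √B / (2 * η) + B / m) *
      (g z * shrink κ (V t) (ψ z) ^ 2 * leverage (V t) (ψ z) ^ 2)
    have hl0 := leverage_nonneg (V t) (ψ z)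
    have hgz := hg0 z
    rcases le_total (leverage (V t) (ψ z)) κ with h | h
    · have hs1 : shrink κ (V t) (ψ z) = 1 := by
        unfold shrink; rw [max_eq_left h, div_self hκ.ne']
      have hw : |ψ z ⬝ᵥ θ t| ≤ √B * leverage (V t) (ψ z) := by
        refine abs_le_of_sq_le_sq ?_ (by positivity)
        rw [mul_pow, Real.sq_sqrt (by linarith), mul_comm]
        refine (sq_dotProduct_le (hpos t) _ _).trans ?_
        rw [sq_leverage (hpos t)]
        refine mul_le_mul_of_nonneg_left ((hquad t ht t le_rfl).trans (hθ t ht)) ?_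
        rw [← sq_leverage (hpos t)]; positivity
      have hw1 : |ψ z ⬝ᵥ θ t| ≤ 1 := by
        refine hw.trans ?_
        calc √B * leverage (V t) (ψ z) ≤ √B * κ := by gcongr
          _ = 1 := mul_inv_cancel₀ hsB.ne'
      rw [hs1]
      set l := leverage (V t) (ψ z)
      have h1 : D t z ≤ K * √B * (g z * l) := by
        refine (hDw t z hw1).trans ?_
        calc K * (g z * |ψ z ⬝ᵥ θ t|) ≤ K * (g z * (√B * l)) := by gcongr
          _ = _ := by ring
      -- AM–GM that leaves a single factor `g` on `l²`, as in the potential; this uses `g² ≤ g`,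
      -- that is `g ≤ 1`.
      have h2 : g z * l ≤ η / 2 + g z * l ^ 2 / (2 * η) := by
        have h3 : η / 2 + g z * l ^ 2 / (2 * η) - g z * l
            = ((η - g z * l) ^ 2 + g z * (1 - g z) * l ^ 2) / (2 * η) := by
          field_simp; ring
        have h4 : 0 ≤ ((η - g z * l) ^ 2 + g z * (1 - g z) * l ^ 2) / (2 * η) := by
          have := hg1 z
          have h5 : 0 ≤ 1 - g z := by linarith
          positivity
        linarith
      calc D t z ≤ K * √B * (η / 2 + g z * l ^ 2 / (2 * η)) :=
            h1.trans (mul_le_mul_of_nonneg_left h2 (by positivity))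
        _ = K * √B / 2 * η + K * √B / (2 * η) * (g z * 1 ^ 2 * l ^ 2) := by ring
        _ ≤ _ := by
            have : 0 ≤ B / m * (g z * 1 ^ 2 * l ^ 2) := by positivity
            nlinarith
    -- Here the leverage is shrunk to exactly `κ`, so the point contributes `g / B ≥ m / B` to the
    -- potential, and the trivial bound `D ≤ 1` is paid for by the factor `B / m`.
    · have hs1 : shrink κ (V t) (ψ z) * leverage (V t) (ψ z) = κ := by
        unfold shrink; rw [max_eq_right h, div_mul_cancel₀ _ (by linarith)]
      have h1 : g z * shrink κ (V t) (ψ z) ^ 2 * leverage (V t) (ψ z) ^ 2 = g z / B := by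
        rw [mul_assoc, ← mul_pow, hs1, hκdef, inv_pow, Real.sq_sqrt (by linarith), div_eq_mul_inv]
      rw [h1]
      have h2 : 1 ≤ B / m * (g z / B) := by
        have : B / m * (g z / B) = g z / m := by field_simp
        rw [this, one_le_div hm]; exact hgm z
      have h3 : 0 ≤ K * √B / 2 * η + K * √B / (2 * η) * (g z / B) := by positivity
      nlinarith [hD1 t z]
  calc ∑ t ∈ Finset.range T, ∫ z, D t z ∂(μ t)
      ≤ ∑ t ∈ Finset.range T, (K * √B / 2 * η + (K * √B / (2 * η) + B / m)
      * ((V t)⁻¹ * gram κ g ψ (V t) (μ t)).trace) :=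
        Finset.sum_le_sum fun t ht => hstep t (Finset.mem_range.1 ht)
    _ = K * √B / 2 * (T * η) + (K * √B / (2 * η) + B / m)
      * ∑ t ∈ Finset.range T, ((V t)⁻¹ * gram κ g ψ (V t) (μ t)).trace := by
        rw [Finset.sum_add_distrib, Finset.sum_const, ← Finset.mul_sum, Finset.card_range,
          nsmul_eq_mul]
        ring
    _ ≤ _ := by gcongr

end Decoupling

/-! ### Gibbs' variational identity for tilted measures. -/

section GibbsMeasure

open InformationTheory

variable {Y : Type*} [MeasurableSpace Y] {μ ν : Measure Y} [IsProbabilityMeasure μ]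
  [IsProbabilityMeasure ν] {f : Y → ℝ}

/-- Gibbs' variational identity. -/
lemma toReal_klDiv_eq_add_tilted (hfν : Integrable f ν)
    (hexp : Integrable (fun y => Real.exp (f y)) μ) (hkl : klDiv ν μ ≠ ∞) :
    (klDiv ν μ).toReal = ∫ y, f y ∂ν - Real.log (∫ y, Real.exp (f y) ∂μ)
      + (klDiv ν (μ.tilted f)).toReal := by
  have := isProbabilityMeasure_tilted hexp
  obtain ⟨hac, hint⟩ := klDiv_ne_top_iff.1 hkl
  have hac' : ν ≪ μ.tilted f := hac.trans (absolutelyContinuous_tilted hexp)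
  rw [toReal_klDiv_of_measure_eq hac (by simp), toReal_klDiv_of_measure_eq hac' (by simp),
    integral_llr_tilted_right hac hfν hexp hint]
  ring

lemma klDiv_tilted_right_ne_top (hfν : Integrable f ν)
    (hexp : Integrable (fun y => Real.exp (f y)) μ) (hkl : klDiv ν μ ≠ ∞) :
    klDiv ν (μ.tilted f) ≠ ∞ := by
  obtain ⟨hac, hint⟩ := klDiv_ne_top_iff.1 hkl
  exact klDiv_ne_top (hac.trans (absolutelyContinuous_tilted hexp))
    (integrable_llr_tilted_right hac hfν hint hexp)

lemma klDiv_tilted_self_ne_top (hexp : Integrable (fun y => Real.exp (f y)) μ)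
    (hf : Integrable f (μ.tilted f)) : klDiv (μ.tilted f) μ ≠ ∞ := by
  have := isProbabilityMeasure_tilted hexp
  refine klDiv_ne_top (tilted_absolutelyContinuous μ f) ?_
  have h := (tilted_absolutelyContinuous μ f).ae_le (log_rnDeriv_tilted_left_self hexp)
  exact (integrable_congr h).2 (hf.sub (integrable_const _))

end GibbsMeasure

/-! ### Rewards of bounded oscillation: integrability, suprema and soft values. -/

section Reward

variable {X Y : Type*} [MeasurableSpace X] [MeasurableSpace Y]

/-- A reward that is integrable in the prompt and whose oscillation over responses is at most
`B`. -/
structure IsBoundedReward (ρ : Measure X) (r : X → Y → ℝ) (B : ℝ) : Prop where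
  measurable : ∀ y, Measurable fun x => r x y
  integrable : ∀ y, Integrable (fun x => r x y) ρ
  abs_sub_le : ∀ x y y', |r x y - r x y'| ≤ B

/-- The largest reward of a response to a prompt. -/
noncomputable def rewardSup (r : X → Y → ℝ) (x : X) : ℝ := ⨆ y, r x y

/-- The regularized value `β log 𝔼_{y ∼ π_ref(·|x)} exp (r(x,y) / β)` of a prompt. -/
noncomputable def softValue (β : ℝ) (πref : Policy X Y) (r : X → Y → ℝ) (x : X) : ℝ :=
  β * Real.log (∫ y, Real.exp (r x y / β) ∂(πref.at x))

instance (π : Policy X Y) (x : X) : IsProbabilityMeasure (π.at x) :=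
  inferInstanceAs (IsProbabilityMeasure (π.kernel x))

/-- The density chosen separately for each prompt need not be jointly measurable; the kernel density
is, and agrees with it almost everywhere. -/
lemma measurable_klDiv_kernel [Countable Y] [MeasurableSingletonClass Y] (π π' : Policy X Y) :
    Measurable fun x => InformationTheory.klDiv (π.at x) (π'.at x) := by
  classical
  simp only [InformationTheory.klDiv_eq_lintegral_klFun]
  refine Measurable.ite (Kernel.measurableSet_absolutelyContinuous π.kernel π'.kernel) ?_
    measurable_const
  have h : ∀ x, ∫⁻ y, ENNReal.ofReal
      (InformationTheory.klFun ((π.at x).rnDeriv (π'.at x) y).toReal) ∂(π'.at x)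
      = ∫⁻ y, ENNReal.ofReal
      (InformationTheory.klFun (Kernel.rnDeriv π.kernel π'.kernel x y).toReal)
        ∂(π'.kernel x) := by
    intro x
    refine lintegral_congr_ae ?_
    filter_upwards [Kernel.rnDeriv_eq_rnDeriv_measure (κ := π.kernel) (η := π'.kernel) (a := x)]
      with y hy
    rw [hy]; rfl
  simp only [h]
  refine Measurable.lintegral_kernel_prod_right ?_
  have h1 := Kernel.measurable_rnDeriv π.kernel π'.kernel
  have h2 := InformationTheory.measurable_klFun
  exact (h2.comp h1.ennreal_toReal).ennreal_ofReal

variable [Countable Y] [MeasurableSingletonClass Y] {ρ : Measure X} [IsProbabilityMeasure ρ]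
  {r : X → Y → ℝ} {B β : ℝ}

namespace IsBoundedReward

omit [IsProbabilityMeasure ρ] in
lemma measurable_uncurry (hr : IsBoundedReward ρ r B) :
    Measurable fun p : X × Y => r p.1 p.2 :=
  measurable_from_prod_countable_left hr.measurable

omit [IsProbabilityMeasure ρ] in
lemma integrable_response (hr : IsBoundedReward ρ r B) (x : X) (ν : Measure Y)
    [IsProbabilityMeasure ν] : Integrable (r x) ν := by
  obtain ⟨y₀⟩ := ν.nonempty_of_neZero
  refine Integrable.of_bound (Measurable.of_discrete).aestronglyMeasurable (|r x y₀| + B)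
    (Filter.Eventually.of_forall fun y => ?_)
  have h1 := hr.abs_sub_le x y y₀
  have h2 := abs_sub_abs_le_abs_sub (r x y) (r x y₀)
  rw [Real.norm_eq_abs]; linarith

omit [IsProbabilityMeasure ρ] in
lemma integrable_exp (hr : IsBoundedReward ρ r B) (hβ : 0 < β) (x : X) (ν : Measure Y)
    [IsProbabilityMeasure ν] : Integrable (fun y => Real.exp (r x y / β)) ν := by
  obtain ⟨y₀⟩ := ν.nonempty_of_neZero
  refine Integrable.of_bound (Measurable.of_discrete).aestronglyMeasurable
    (Real.exp ((r x y₀ + B) / β)) (Filter.Eventually.of_forall fun y => ?_)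
  rw [Real.norm_eq_abs, Real.abs_exp]
  have h1 := (abs_le.1 (hr.abs_sub_le x y y₀)).2
  gcongr
  linarith

omit [IsProbabilityMeasure ρ] in
lemma measurable_expected (hr : IsBoundedReward ρ r B) (π : Policy X Y) :
    Measurable fun x => ∫ y, r x y ∂(π.at x) :=
  (StronglyMeasurable.integral_kernel_prod_right (κ := π.kernel)
    hr.measurable_uncurry.stronglyMeasurable).measurable

omit [MeasurableSingletonClass Y] [Countable Y] [IsProbabilityMeasure ρ] in
lemma abs_expected_sub_le (hr : IsBoundedReward ρ r B) (x : X) (ν : Measure Y)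
    [IsProbabilityMeasure ν] (hint : Integrable (r x) ν) (y₀ : Y) :
    |∫ y, r x y ∂ν - r x y₀| ≤ B := by
  have h : ∫ y, r x y ∂ν - r x y₀ = ∫ y, (r x y - r x y₀) ∂ν := by
    rw [integral_sub hint (integrable_const _)]; simp
  rw [h]
  have := norm_integral_le_of_norm_le_const (μ := ν) (f := fun y => r x y - r x y₀) (C := B)
    (Filter.Eventually.of_forall fun y => hr.abs_sub_le x y y₀)
  simpa using this

omit [MeasurableSpace Y] [Countable Y] [MeasurableSingletonClass Y] in
lemma integrable_of_abs_sub_le (hr : IsBoundedReward ρ r B) {F : X → ℝ} (hF : Measurable F)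
    (y₀ : Y) (h : ∀ x, |F x - r x y₀| ≤ B) : Integrable F ρ := by
  have h1 : Integrable (fun x => F x - r x y₀) ρ :=
    Integrable.of_bound (hF.sub (hr.measurable y₀)).aestronglyMeasurable B
      (Filter.Eventually.of_forall h)
  exact (h1.add (hr.integrable y₀)).congr (Filter.Eventually.of_forall fun x => by simp)

lemma integrable_expected [Nonempty Y] (hr : IsBoundedReward ρ r B) (π : Policy X Y) :
    Integrable (fun x => ∫ y, r x y ∂(π.at x)) ρ :=
  hr.integrable_of_abs_sub_le (hr.measurable_expected π) (Classical.arbitrary Y)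
    fun x => hr.abs_expected_sub_le x _ (hr.integrable_response x _) _

omit [MeasurableSpace Y] [IsProbabilityMeasure ρ] [Countable Y]
  [MeasurableSingletonClass Y] in
lemma bddAbove (hr : IsBoundedReward ρ r B) (x : X) : BddAbove (Set.range (r x)) := by
  rcases isEmpty_or_nonempty Y with h | ⟨⟨y₀⟩⟩
  · simp
  refine ⟨r x y₀ + B, ?_⟩
  rintro _ ⟨y, rfl⟩
  linarith [(abs_le.1 (hr.abs_sub_le x y y₀)).2]

omit [MeasurableSpace Y] [IsProbabilityMeasure ρ] [Countable Y]
  [MeasurableSingletonClass Y] in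
lemma le_rewardSup (hr : IsBoundedReward ρ r B) (x : X) (y : Y) : r x y ≤ rewardSup r x :=
  le_ciSup (hr.bddAbove x) y

omit [MeasurableSpace Y] [IsProbabilityMeasure ρ] [MeasurableSingletonClass Y] in
lemma measurable_rewardSup (hr : IsBoundedReward ρ r B) : Measurable (rewardSup r) :=
  Measurable.iSup hr.measurable

omit [MeasurableSpace Y] [IsProbabilityMeasure ρ] [Countable Y]
  [MeasurableSingletonClass Y] in
lemma abs_rewardSup_sub_le [Nonempty Y] (hr : IsBoundedReward ρ r B) (x : X) (y₀ : Y) :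
    |rewardSup r x - r x y₀| ≤ B := by
  rw [abs_of_nonneg (by linarith [hr.le_rewardSup x y₀])]
  have : rewardSup r x ≤ r x y₀ + B :=
    ciSup_le fun y => by linarith [(abs_le.1 (hr.abs_sub_le x y y₀)).2]
  linarith

omit [MeasurableSpace Y] [MeasurableSingletonClass Y] in
lemma integrable_rewardSup [Nonempty Y] (hr : IsBoundedReward ρ r B) :
    Integrable (rewardSup r) ρ :=
  hr.integrable_of_abs_sub_le hr.measurable_rewardSup (Classical.arbitrary Y)
    fun x => hr.abs_rewardSup_sub_le x _

omit [IsProbabilityMeasure ρ] in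
lemma measurable_softValue (hr : IsBoundedReward ρ r B) (πref : Policy X Y) :
    Measurable (softValue β πref r) := by
  have h : Measurable fun p : X × Y => Real.exp (r p.1 p.2 / β) :=
    (hr.measurable_uncurry.div_const β).exp
  exact ((StronglyMeasurable.integral_kernel_prod_right' (κ := πref.kernel)
    h.stronglyMeasurable).measurable.log).const_mul β

omit [IsProbabilityMeasure ρ] in
lemma softValue_le (hr : IsBoundedReward ρ r B) (hβ : 0 < β) (πref : Policy X Y) (x : X) (a : ℝ)
    (h : ∀ y, r x y ≤ a) : softValue β πref r x ≤ a := by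
  have h1 : ∫ y, Real.exp (r x y / β) ∂(πref.at x) ≤ Real.exp (a / β) := by
    calc _ ≤ ∫ _, Real.exp (a / β) ∂(πref.at x) := by
          refine integral_mono (hr.integrable_exp hβ x _) (integrable_const _) fun y => ?_
          have := h y
          dsimp only
          gcongr
      _ = _ := by simp
  have h2 := Real.log_le_log (integral_exp_pos (hr.integrable_exp hβ x (πref.at x))) h1
  rw [Real.log_exp, le_div_iff₀ hβ] at h2
  unfold softValue; linarith

omit [IsProbabilityMeasure ρ] in
lemma le_softValue (hr : IsBoundedReward ρ r B) (hβ : 0 < β) (πref : Policy X Y) (x : X) (a : ℝ)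
    (h : ∀ y, a ≤ r x y) : a ≤ softValue β πref r x := by
  have h1 : Real.exp (a / β) ≤ ∫ y, Real.exp (r x y / β) ∂(πref.at x) := by
    calc _ = ∫ _, Real.exp (a / β) ∂(πref.at x) := by simp
      _ ≤ _ := by
          refine integral_mono (integrable_const _) (hr.integrable_exp hβ x _) fun y => ?_
          have := h y
          dsimp only
          gcongr
  have h2 := Real.log_le_log (Real.exp_pos _) h1
  rw [Real.log_exp, div_le_iff₀ hβ] at h2
  unfold softValue; linarith

omit [IsProbabilityMeasure ρ] in
lemma softValue_le_rewardSup (hr : IsBoundedReward ρ r B) (hβ : 0 < β) (πref : Policy X Y)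
    (x : X) : softValue β πref r x ≤ rewardSup r x :=
  hr.softValue_le hβ πref x _ (hr.le_rewardSup x)

lemma integrable_softValue [Nonempty Y] (hr : IsBoundedReward ρ r B) (hβ : 0 < β)
    (πref : Policy X Y) : Integrable (softValue β πref r) ρ := by
  refine hr.integrable_of_abs_sub_le (hr.measurable_softValue πref) (Classical.arbitrary Y)
    fun x => abs_le.2 ⟨?_, ?_⟩
  · linarith [hr.le_softValue hβ πref x (r x (Classical.arbitrary Y) - B) fun y => by
      linarith [(abs_le.1 (hr.abs_sub_le x y (Classical.arbitrary Y))).1]]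
  · linarith [hr.softValue_le hβ πref x (r x (Classical.arbitrary Y) + B) fun y => by
      linarith [(abs_le.1 (hr.abs_sub_le x y (Classical.arbitrary Y))).2]]

lemma integrable_expected_sub_softValue [Nonempty Y] (hr : IsBoundedReward ρ r B) (hβ : 0 < β)
    (πref π : Policy X Y) :
    Integrable (fun x => ∫ y, r x y ∂(π.at x) - softValue β πref r x) ρ :=
  (hr.integrable_expected π).sub (hr.integrable_softValue hβ πref)

end IsBoundedReward

end Reward

/-! ### Regularized optimal policies are Gibbs policies; the regularization gap. -/

section Gibbs

variable {X Y : Type*} [MeasurableSpace X] [MeasurableSpace Y]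
  [Countable Y] [MeasurableSingletonClass Y] {ρ : Measure X} [IsProbabilityMeasure ρ]
  {r : X → Y → ℝ} {B β : ℝ}

omit [Countable Y] [MeasurableSingletonClass Y] in
lemma _root_.MeasureTheory.Measure.nonempty_response (ρ : Measure X) [IsProbabilityMeasure ρ]
    (π : Policy X Y) : Nonempty Y := by
  obtain ⟨x⟩ := ρ.nonempty_of_neZero
  exact (π.at x).nonempty_of_neZero

/-- The Gibbs policy `π(y|x) ∝ π_ref(y|x) exp (r(x,y) / β)`. -/
noncomputable def gibbs (hr : IsBoundedReward ρ r B) (hβ : 0 < β) (πref : Policy X Y) :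
    Policy X Y where
  kernel :=
    { toFun := fun x => (πref.at x).tilted fun y => r x y / β
      measurable' := by
        have h1 : Measurable fun p : X × Y => Real.exp (r p.1 p.2 / β) :=
          (hr.measurable_uncurry.div_const β).exp
        have h2 : Measurable fun x => ∫ y, Real.exp (r x y / β) ∂(πref.at x) :=
          (StronglyMeasurable.integral_kernel_prod_right' (κ := πref.kernel)
            h1.stronglyMeasurable).measurable
        have h3 : Measurable (Function.uncurry fun x y => ENNReal.ofReal
            (Real.exp (r x y / β) / ∫ y, Real.exp (r x y / β) ∂(πref.at x))) :=
          (h1.div (h2.comp measurable_fst)).ennreal_ofReal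
        have h4 := (Kernel.withDensity πref.kernel fun x y => ENNReal.ofReal
            (Real.exp (r x y / β) / ∫ y, Real.exp (r x y / β) ∂(πref.at x))).measurable
        convert h4 using 1
        ext1 x
        rw [Kernel.withDensity_apply _ h3]
        rfl }
  isMarkovKernel := ⟨fun x => isProbabilityMeasure_tilted (hr.integrable_exp hβ x _)⟩

omit [IsProbabilityMeasure ρ] in
lemma gibbs_at (hr : IsBoundedReward ρ r B) (hβ : 0 < β) (πref : Policy X Y) (x : X) :
    (gibbs hr hβ πref).at x = (πref.at x).tilted fun y => r x y / β := rfl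

omit [IsProbabilityMeasure ρ] in
/-- The variational identity for the regularized value of a prompt. -/
lemma mul_toReal_klDiv_eq (hr : IsBoundedReward ρ r B) (hβ : 0 < β) (πref π : Policy X Y) (x : X)
    (hkl : InformationTheory.klDiv (π.at x) (πref.at x) ≠ ∞) :
    β * (InformationTheory.klDiv (π.at x) (πref.at x)).toReal
      = ∫ y, r x y ∂(π.at x) - softValue β πref r x
        + β * (InformationTheory.klDiv (π.at x) ((gibbs hr hβ πref).at x)).toReal := by
  rw [gibbs_at, toReal_klDiv_eq_add_tilted ((hr.integrable_response x (π.at x)).div_const β)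
    (hr.integrable_exp hβ x _) hkl, integral_div]
  unfold softValue
  field_simp

omit [IsProbabilityMeasure ρ] in
lemma ofReal_sub_softValue_le (hr : IsBoundedReward ρ r B) (hβ : 0 < β) (πref π : Policy X Y)
    (x : X) : ENNReal.ofReal (∫ y, r x y ∂(π.at x) - softValue β πref r x)
      ≤ ENNReal.ofReal β * InformationTheory.klDiv (π.at x) (πref.at x) := by
  by_cases hkl : InformationTheory.klDiv (π.at x) (πref.at x) = ∞
  · rw [hkl, ENNReal.mul_top (by simpa using hβ)]
    exact le_top
  · have h := mul_toReal_klDiv_eq hr hβ πref π x hkl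
    rw [← ENNReal.ofReal_toReal hkl, ← ENNReal.ofReal_mul hβ.le, h]
    refine ENNReal.ofReal_le_ofReal ?_
    have : 0 ≤ β * (InformationTheory.klDiv (π.at x) ((gibbs hr hβ πref).at x)).toReal := by
      positivity
    linarith

omit [IsProbabilityMeasure ρ] in
lemma klDiv_gibbs_ne_top (hr : IsBoundedReward ρ r B) (hβ : 0 < β) (πref : Policy X Y) (x : X) :
    InformationTheory.klDiv ((gibbs hr hβ πref).at x) (πref.at x) ≠ ∞ :=
  klDiv_tilted_self_ne_top (hr.integrable_exp hβ x _)
    ((hr.integrable_response x ((gibbs hr hβ πref).at x)).div_const β)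

omit [IsProbabilityMeasure ρ] in
lemma mul_klDiv_gibbs (hr : IsBoundedReward ρ r B) (hβ : 0 < β) (πref : Policy X Y) (x : X) :
    softValue β πref r x ≤ ∫ y, r x y ∂((gibbs hr hβ πref).at x) ∧
    ENNReal.ofReal β * InformationTheory.klDiv ((gibbs hr hβ πref).at x) (πref.at x)
      = ENNReal.ofReal (∫ y, r x y ∂((gibbs hr hβ πref).at x) - softValue β πref r x) := by
  have hkl := klDiv_gibbs_ne_top hr hβ πref x
  have h := mul_toReal_klDiv_eq hr hβ πref (gibbs hr hβ πref) x hkl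
  rw [InformationTheory.klDiv_self, ENNReal.toReal_zero, mul_zero, add_zero] at h
  constructor
  · have : 0 ≤ β * (InformationTheory.klDiv ((gibbs hr hβ πref).at x) (πref.at x)).toReal := by
      positivity
    linarith
  · rw [← ENNReal.ofReal_toReal hkl, ← ENNReal.ofReal_mul hβ.le, h]

omit [IsProbabilityMeasure ρ] in
lemma ofReal_integral_le_lintegral_ofReal {f : X → ℝ} (hf : Integrable f ρ) :
    ENNReal.ofReal (∫ x, f x ∂ρ) ≤ ∫⁻ x, ENNReal.ofReal (f x) ∂ρ := by
  have h := ofReal_integral_eq_lintegral_ofReal hf.pos_part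
    (Filter.Eventually.of_forall fun x => le_max_right _ _)
  calc ENNReal.ofReal (∫ x, f x ∂ρ) ≤ ENNReal.ofReal (∫ x, max (f x) 0 ∂ρ) :=
        ENNReal.ofReal_le_ofReal (integral_mono hf hf.pos_part fun x => le_max_left _ _)
    _ = ∫⁻ x, ENNReal.ofReal (f x) ∂ρ := by
        rw [h]
        refine lintegral_congr fun x => ?_
        rw [ENNReal.ofReal_max, ENNReal.ofReal_zero, max_eq_left zero_le]

lemma ofReal_expReward_sub_le (hr : IsBoundedReward ρ r B) (hβ : 0 < β) (πref π : Policy X Y) :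
    ENNReal.ofReal (expReward ρ r π - ∫ x, softValue β πref r x ∂ρ)
      ≤ ENNReal.ofReal β * expKL ρ π πref := by
  have := ρ.nonempty_response πref
  unfold expReward expKL
  rw [← integral_sub (hr.integrable_expected π) (hr.integrable_softValue hβ πref),
    ← lintegral_const_mul' _ _ ENNReal.ofReal_ne_top]
  exact (ofReal_integral_le_lintegral_ofReal (hr.integrable_expected_sub_softValue hβ πref π)).trans
    (lintegral_mono fun x => ofReal_sub_softValue_le hr hβ πref π x)

/-- On every prompt the penalty of the Gibbs policy is exactly its expected reward minus the soft
value, so the expected reward cancels. In particular the optimal value is finite. -/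
lemma J_gibbs (hr : IsBoundedReward ρ r B) (hβ : 0 < β) (πref : Policy X Y) :
    J ρ β πref r (gibbs hr hβ πref) = ((∫ x, softValue β πref r x ∂ρ : ℝ) : EReal) := by
  have := ρ.nonempty_response πref
  have h1 : ENNReal.ofReal β * expKL ρ (gibbs hr hβ πref) πref
      = ENNReal.ofReal (expReward ρ r (gibbs hr hβ πref) - ∫ x, softValue β πref r x ∂ρ) := by
    unfold expReward expKL
    rw [← integral_sub (hr.integrable_expected _) (hr.integrable_softValue hβ πref),
      ← lintegral_const_mul' _ _ ENNReal.ofReal_ne_top,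
      ofReal_integral_eq_lintegral_ofReal
        (hr.integrable_expected_sub_softValue hβ πref _)
        (Filter.Eventually.of_forall fun x => sub_nonneg.2 (mul_klDiv_gibbs hr hβ πref x).1)]
    exact lintegral_congr fun x => (mul_klDiv_gibbs hr hβ πref x).2
  have h2 : 0 ≤ expReward ρ r (gibbs hr hβ πref) - ∫ x, softValue β πref r x ∂ρ :=
    sub_nonneg.2 (integral_mono (hr.integrable_softValue hβ πref) (hr.integrable_expected _)
      fun x => (mul_klDiv_gibbs hr hβ πref x).1)
  unfold J
  rw [h1, EReal.coe_ennreal_ofReal, max_eq_left h2, ← EReal.coe_sub]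
  congr 1
  ring

/-- A maximizer of the regularized objective is the Gibbs policy on almost every prompt. -/
theorem IsRegularizedOptimal.ae_eq_gibbs (hr : IsBoundedReward ρ r B) (hβ : 0 < β)
    {πref π : Policy X Y} (hπ : IsRegularizedOptimal ρ β πref r π) :
    ∀ᵐ x ∂ρ, π.at x = (gibbs hr hβ πref).at x := by
  have := ρ.nonempty_response πref
  have h := hπ (gibbs hr hβ πref)
  rw [J_gibbs] at h
  unfold J at h
  -- An infinite penalty would make the maximal value `-∞`, while the Gibbs policy has a finite one.
  have hne : ENNReal.ofReal β * expKL ρ π πref ≠ ∞ := by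
    intro htop
    rw [htop] at h
    simp at h
  have hkl : expKL ρ π πref ≠ ∞ := by
    intro htop
    rw [htop, ENNReal.mul_top (by simpa using hβ)] at hne
    exact hne rfl
  have h1 : β * (expKL ρ π πref).toReal
      ≤ expReward ρ r π - ∫ x, softValue β πref r x ∂ρ := by
    rw [← ENNReal.ofReal_toReal hkl, ← ENNReal.ofReal_mul hβ.le, EReal.coe_ennreal_ofReal,
      max_eq_left (by positivity), ← EReal.coe_sub, EReal.coe_le_coe_iff] at h
    linarith
  have hmeas := measurable_klDiv_kernel π πref
  have hfin : ∀ᵐ x ∂ρ, InformationTheory.klDiv (π.at x) (πref.at x) ≠ ∞ := by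
    filter_upwards [ae_lt_top hmeas hkl] with x hx using hx.ne
  have hint : Integrable
      (fun x => (InformationTheory.klDiv (π.at x) (πref.at x)).toReal) ρ :=
    integrable_toReal_of_lintegral_ne_top hmeas.aemeasurable hkl
  have hid : ∀ᵐ x ∂ρ,
      β * (InformationTheory.klDiv (π.at x) ((gibbs hr hβ πref).at x)).toReal
        = β * (InformationTheory.klDiv (π.at x) (πref.at x)).toReal
          - (∫ y, r x y ∂(π.at x) - softValue β πref r x) := by
    filter_upwards [hfin] with x hx
    linarith [mul_toReal_klDiv_eq hr hβ πref π x hx]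
  have hint2 := (hint.const_mul β).sub
    (hr.integrable_expected_sub_softValue hβ πref π)
  have hint3 := hint2.congr (hid.mono fun x hx => hx.symm)
  -- The deficit of `π` against the Gibbs policy is the mean divergence between the two; optimality
  -- forces this nonnegative quantity to vanish.
  have hzero : ∫ x, β * (InformationTheory.klDiv (π.at x) ((gibbs hr hβ πref).at x)).toReal ∂ρ
      ≤ 0 := by
    rw [integral_congr_ae hid, integral_sub (hint.const_mul β)
      (hr.integrable_expected_sub_softValue hβ πref π),
      integral_sub (hr.integrable_expected π) (hr.integrable_softValue hβ πref),
      integral_const_mul, integral_toReal hmeas.aemeasurable (hfin.mono fun x hx => hx.lt_top)]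
    unfold expReward expKL at h1
    linarith
  have hnn : 0 ≤ᵐ[ρ] fun x =>
      β * (InformationTheory.klDiv (π.at x) ((gibbs hr hβ πref).at x)).toReal :=
    Filter.Eventually.of_forall fun x => by positivity
  have hae := (integral_eq_zero_iff_of_nonneg_ae hnn hint3).1
    (le_antisymm hzero (integral_nonneg_of_ae hnn))
  filter_upwards [hae, hfin] with x hx hx2
  have h3 : (InformationTheory.klDiv (π.at x) ((gibbs hr hβ πref).at x)).toReal = 0 := by
    simpa [hβ.ne'] using hx
  rw [ENNReal.toReal_eq_zero_iff] at h3
  rcases h3 with h3 | h3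
  · exact InformationTheory.klDiv_eq_zero_iff.1 h3
  · exact absurd h3 (klDiv_tilted_right_ne_top ((hr.integrable_response x _).div_const β)
      (hr.integrable_exp hβ x _) hx2)

omit [IsProbabilityMeasure ρ] in
-- The implicit reward of DPO. The response must have positive reference mass, since `logRatio` has
-- the value of `log 0` otherwise.
lemma mul_logRatio_of_at_eq_gibbs (hr : IsBoundedReward ρ r B) (hβ : 0 < β)
    {πref π : Policy X Y} {x : X} (hx : π.at x = (gibbs hr hβ πref).at x) {y : Y}
    (hy : πref.at x {y} ≠ 0) :
    β * logRatio πref π x y = r x y - softValue β πref r x := by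
  have hpos : 0 < πref.prob x y := ENNReal.toReal_pos hy (measure_ne_top _ _)
  have hZ := integral_exp_pos (hr.integrable_exp hβ x (πref.at x))
  have h1 : π.prob x y = Real.exp (r x y / β) / (∫ y, Real.exp (r x y / β) ∂(πref.at x))
      * πref.prob x y := by
    unfold Policy.prob Measure.real
    rw [hx, gibbs_at, tilted_apply, lintegral_singleton, ENNReal.toReal_mul,
      ENNReal.toReal_ofReal (by positivity)]
  unfold logRatio softValue
  rw [h1, mul_div_assoc, div_self hpos.ne', mul_one, Real.log_div (Real.exp_pos _).ne' hZ.ne',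
    Real.log_exp]
  field_simp

omit [IsProbabilityMeasure ρ] in
lemma gibbs_absolutelyContinuous (hr : IsBoundedReward ρ r B) (hβ : 0 < β) (πref : Policy X Y)
    (x : X) : (gibbs hr hβ πref).at x ≪ πref.at x :=
  tilted_absolutelyContinuous _ _

/-- Reward-optimal policies attain the pointwise supremum of the reward in expectation. -/
theorem IsRewardOptimal.integral_rewardSup_le (hr : IsBoundedReward ρ r B) {π : Policy X Y}
    (hπ : IsRewardOptimal ρ r π) : ∫ x, rewardSup r x ∂ρ ≤ expReward ρ r π := by
  classical
  have hne := ρ.nonempty_response π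
  refine le_of_forall_pos_le_add fun ε hε => ?_
  -- Measurable selection: along an enumeration of the countable response set, take the first
  -- response whose reward is within `ε` of the supremum.
  obtain ⟨e, he⟩ := exists_surjective_nat Y
  have hex : ∀ x, ∃ k, rewardSup r x - ε ≤ r x (e k) := by
    intro x
    obtain ⟨y, hy⟩ := exists_lt_of_lt_ciSup (show rewardSup r x - ε < ⨆ y, r x y by
      change _ < rewardSup r x; linarith)
    obtain ⟨k, rfl⟩ := he y
    exact ⟨k, hy.le⟩
  have hs : Measurable fun x => e (Nat.find (hex x)) :=
    Measurable.of_discrete.comp (measurable_find hex fun k =>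
      measurableSet_le (hr.measurable_rewardSup.sub_const ε) (hr.measurable (e k)))
  have h := hπ ⟨Kernel.deterministic _ hs, inferInstance⟩
  refine le_trans ?_ (add_le_add_left h ε)
  unfold expReward
  have h1 : ∀ x, ∫ y, r x y ∂((⟨Kernel.deterministic _ hs, inferInstance⟩ : Policy X Y).at x)
      = r x (e (Nat.find (hex x))) := by
    intro x
    unfold Policy.at
    simp only [Kernel.deterministic_apply]
    rw [integral_dirac]
  have h2 := hr.integrable_expected ⟨Kernel.deterministic _ hs, inferInstance⟩
  simp only [h1] at h2 ⊢
  have h3 : ∫ x, r x (e (Nat.find (hex x))) ∂ρ + ε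
      = ∫ x, (r x (e (Nat.find (hex x))) + ε) ∂ρ := by
    rw [integral_add h2 (integrable_const _)]; simp
  rw [h3]
  refine integral_mono hr.integrable_rewardSup (h2.add (integrable_const _)) fun x => ?_
  have := Nat.find_spec (hex x)
  dsimp only
  linarith

/-- The regularization gap: the value lost by regularizing is at most `β` times the divergence of
a reward-optimal policy. -/
theorem integral_rewardSup_sub_softValue_le (hr : IsBoundedReward ρ r B) (hβ : 0 < β)
    {πref π : Policy X Y} (hπ : IsRewardOptimal ρ r π) (hkl : expKL ρ π πref ≠ ∞) :
    ∫ x, rewardSup r x ∂ρ - ∫ x, softValue β πref r x ∂ρ ≤ β * (expKL ρ π πref).toReal := by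
  have h1 := ofReal_expReward_sub_le hr hβ πref π
  rw [← ENNReal.ofReal_toReal hkl, ← ENNReal.ofReal_mul hβ.le,
    ENNReal.ofReal_le_ofReal_iff (by positivity)] at h1
  have h2 := hπ.integral_rewardSup_le hr
  linarith

end Gibbs

/-! ### The law of one comparison and the exponential moment of its likelihood ratio. -/

section RoundLaw

variable {X Y : Type*} [MeasurableSpace X] [MeasurableSpace Y]

/-- The law of a prompt with a response of `π` and a response of the sampler. -/
noncomputable def pairLaw (ρ : Measure X) (π πsam : Policy X Y) : Measure (X × Y × Y) :=
  ρ ⊗ₘ (π.kernel ×ₖ πsam.kernel)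

instance (ρ : Measure X) [IsProbabilityMeasure ρ] (π πsam : Policy X Y) :
    IsProbabilityMeasure (pairLaw ρ π πsam) := by unfold pairLaw; infer_instance

/-- The reward difference of two responses. -/
def rewardDiff (r : X → Y → ℝ) (p : X × Y × Y) : ℝ := r p.1 p.2.1 - r p.1 p.2.2

/-- The log-likelihood of a labelled comparison in the Bradley–Terry model with reward `r`. -/
noncomputable def logLik (r : X → Y → ℝ) (z : Sample X Y) : ℝ :=
  Real.log (Real.sigmoid (r z.prompt z.winner - r z.prompt z.loser))

omit [MeasurableSpace X] [MeasurableSpace Y] in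
lemma logLik_true (r : X → Y → ℝ) (p : X × Y × Y) :
    logLik r (p, true) = Real.log (Real.sigmoid (rewardDiff r p)) := rfl

omit [MeasurableSpace X] [MeasurableSpace Y] in
lemma logLik_false (r : X → Y → ℝ) (p : X × Y × Y) :
    logLik r (p, false) = Real.log (1 - Real.sigmoid (rewardDiff r p)) := by
  rw [← Real.sigmoid_neg]
  unfold rewardDiff
  rw [neg_sub]
  rfl

/-- The conditional information of one round about `r`: the expected Hellinger-type discrepancy
between the preferences of `r` and of the true reward. -/
noncomputable def hellingerGap (ρ : Measure X) (r rstar : X → Y → ℝ) (π πsam : Policy X Y) : ℝ :=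
  ∫ p, (1 - affinity (rewardDiff r p) (rewardDiff rstar p)) ∂(pairLaw ρ π πsam)

variable [Countable Y] [MeasurableSingletonClass Y] {r rstar : X → Y → ℝ}

lemma measurable_rewardDiff (hr : ∀ y, Measurable fun x => r x y) :
    Measurable (rewardDiff r) := by
  have h : Measurable fun p : X × Y => r p.1 p.2 := measurable_from_prod_countable_left hr
  exact (h.comp (measurable_fst.prodMk measurable_snd.fst)).sub
    (h.comp (measurable_fst.prodMk measurable_snd.snd))

lemma measurable_logLik (hr : ∀ y, Measurable fun x => r x y) : Measurable (logLik r) := by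
  have h1 : Measurable fun p => logLik r (p, true) := by
    simp only [logLik_true]
    exact (continuous_sigmoid.measurable.comp (measurable_rewardDiff hr)).log
  have h2 : Measurable fun p => logLik r (p, false) := by
    simp only [logLik_false]
    exact (measurable_const.sub (continuous_sigmoid.measurable.comp (measurable_rewardDiff hr))).log
  refine measurable_from_prod_countable_left fun b => ?_
  cases b
  · exact h2
  · exact h1

lemma measurable_affinity_rewardDiff (hr : ∀ y, Measurable fun x => r x y)
    (hs : ∀ y, Measurable fun x => rstar x y) :
    Measurable fun p => affinity (rewardDiff r p) (rewardDiff rstar p) :=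
  continuous_affinity.measurable.comp ((measurable_rewardDiff hr).prodMk (measurable_rewardDiff hs))

lemma lintegral_roundLaw (hs : ∀ y, Measurable fun x => rstar x y) (ρ : Measure X)
    (π πsam : Policy X Y) {f : Sample X Y → ℝ≥0∞} (hf : Measurable f) :
    ∫⁻ z, f z ∂(roundLaw ρ rstar π πsam)
      = ∫⁻ p, (ENNReal.ofReal (Real.sigmoid (rewardDiff rstar p)) * f (p, true)
        + ENNReal.ofReal (1 - Real.sigmoid (rewardDiff rstar p)) * f (p, false))
          ∂(pairLaw ρ π πsam) := by
  have hσ : Measurable fun p => Real.sigmoid (rewardDiff rstar p) :=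
    continuous_sigmoid.measurable.comp (measurable_rewardDiff hs)
  have h1 : Measurable fun p : X × Y × Y => f (p, true) := hf.comp (by fun_prop)
  have h2 : Measurable fun p : X × Y × Y => f (p, false) := hf.comp (by fun_prop)
  have e1 : Measurable fun p : X × Y × Y => ENNReal.ofReal (pref rstar p.1 p.2.1 p.2.2) :=
    hσ.ennreal_ofReal
  have e2 : Measurable fun p : X × Y × Y => ENNReal.ofReal (1 - pref rstar p.1 p.2.1 p.2.2) :=
    (measurable_const.sub hσ).ennreal_ofReal
  unfold roundLaw
  rw [lintegral_add_measure, lintegral_map hf (by fun_prop), lintegral_map hf (by fun_prop),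
    lintegral_withDensity_eq_lintegral_mul _ e1 h1, lintegral_withDensity_eq_lintegral_mul _ e2 h2,
    ← lintegral_add_left (e1.mul h1)]
  rfl

omit [Countable Y] [MeasurableSingletonClass Y] in
lemma hellingerGap_nonneg (ρ : Measure X) (π πsam : Policy X Y) (r rstar : X → Y → ℝ) :
    0 ≤ hellingerGap ρ r rstar π πsam :=
  integral_nonneg fun _ => sub_nonneg.2 (affinity_le_one _ _)

/-- The exponential moment of half the log-likelihood ratio, compensated by the Hellinger gap. -/
lemma lintegral_exp_logLik_le (hr : ∀ y, Measurable fun x => r x y)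
    (hs : ∀ y, Measurable fun x => rstar x y) (ρ : Measure X) [IsProbabilityMeasure ρ]
    (π πsam : Policy X Y) :
    ∫⁻ z, ENNReal.ofReal (Real.exp ((logLik r z - logLik rstar z) / 2
        + hellingerGap ρ r rstar π πsam)) ∂(roundLaw ρ rstar π πsam) ≤ 1 := by
  set H := hellingerGap ρ r rstar π πsam with hH
  have hmeas : Measurable fun z => ENNReal.ofReal
      (Real.exp ((logLik r z - logLik rstar z) / 2 + H)) :=
    (((((measurable_logLik hr).sub (measurable_logLik hs)).div_const 2).add_const H).exp).ennreal_ofReal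
  -- Under the true label probability `u`, half the log-ratio turns `u` into `√(v u)`; adding the
  -- two labels produces the affinity.
  have hhalf : ∀ u v : ℝ, 0 < u → 0 < v →
      u * Real.exp ((Real.log v - Real.log u) / 2) = √(v * u) := by
    intro u v hu hv
    rw [eq_comm, Real.sqrt_eq_iff_mul_self_eq (by positivity) (by positivity)]
    have h1 : Real.exp ((Real.log v - Real.log u) / 2) * Real.exp ((Real.log v - Real.log u) / 2)
        = v / u := by
      rw [← Real.exp_add, add_halves, Real.exp_sub, Real.exp_log hv, Real.exp_log hu]
    refine Eq.symm ?_
    calc _ = u * u * (Real.exp ((Real.log v - Real.log u) / 2)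
          * Real.exp ((Real.log v - Real.log u) / 2)) := by ring
      _ = v * u := by rw [h1]; field_simp
  have hpt : ∀ p, ENNReal.ofReal (Real.sigmoid (rewardDiff rstar p)) * ENNReal.ofReal
        (Real.exp ((logLik r (p, true) - logLik rstar (p, true)) / 2 + H))
      + ENNReal.ofReal (1 - Real.sigmoid (rewardDiff rstar p)) * ENNReal.ofReal
        (Real.exp ((logLik r (p, false) - logLik rstar (p, false)) / 2 + H))
      = ENNReal.ofReal (affinity (rewardDiff r p) (rewardDiff rstar p) * Real.exp H) := by
    intro p
    have h0 := Real.sigmoid_pos (rewardDiff rstar p)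
    have h1 : 0 < 1 - Real.sigmoid (rewardDiff rstar p) := by
      linarith [Real.sigmoid_lt_one (rewardDiff rstar p)]
    have h0' := Real.sigmoid_pos (rewardDiff r p)
    have h1' : 0 < 1 - Real.sigmoid (rewardDiff r p) := by
      linarith [Real.sigmoid_lt_one (rewardDiff r p)]
    rw [← ENNReal.ofReal_mul h0.le, ← ENNReal.ofReal_mul h1.le,
      ← ENNReal.ofReal_add (by positivity) (by positivity), logLik_true, logLik_true, logLik_false,
      logLik_false, Real.exp_add, Real.exp_add, ← mul_assoc, ← mul_assoc, hhalf _ _ h0 h0',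
      hhalf _ _ h1 h1', ← add_mul]
    rfl
  rw [lintegral_roundLaw hs ρ π πsam hmeas, lintegral_congr hpt]
  have haff := measurable_affinity_rewardDiff hr hs
  have hint : Integrable (fun p => affinity (rewardDiff r p) (rewardDiff rstar p))
      (pairLaw ρ π πsam) := integrable_of_bounded haff 1 fun p => by
    rw [abs_of_nonneg (affinity_nonneg _ _)]; exact affinity_le_one _ _
  rw [← ofReal_integral_eq_lintegral_ofReal (hint.mul_const _)
    (Filter.Eventually.of_forall fun p => mul_nonneg (affinity_nonneg _ _) (Real.exp_pos _).le),
    integral_mul_const]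
  have h2 : ∫ p, affinity (rewardDiff r p) (rewardDiff rstar p) ∂(pairLaw ρ π πsam) = 1 - H := by
    rw [hH, hellingerGap, integral_sub (integrable_const _) hint]; simp
  rw [h2]
  refine ENNReal.ofReal_le_one.2 ?_
  have h3 := Real.add_one_le_exp (-H)
  calc (1 - H) * Real.exp H ≤ Real.exp (-H) * Real.exp H := by gcongr; linarith
    _ = 1 := by rw [← Real.exp_add]; simp

omit [Countable Y] [MeasurableSingletonClass Y] in
lemma ae_roundLaw_of_ae_pairLaw (ρ : Measure X) (π πsam : Policy X Y) {Q : X × Y × Y → Prop}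
    (h : ∀ᵐ p ∂(pairLaw ρ π πsam), Q p) : ∀ᵐ z ∂(roundLaw ρ rstar π πsam), Q z.1 := by
  have hq : Measure.QuasiMeasurePreserving (Prod.fst : Sample X Y → X × Y × Y)
      (roundLaw ρ rstar π πsam) (pairLaw ρ π πsam) := by
    refine ⟨measurable_fst, ?_⟩
    unfold roundLaw
    rw [Measure.map_add _ _ measurable_fst, Measure.map_map measurable_fst (by fun_prop),
      Measure.map_map measurable_fst (by fun_prop)]
    simp only [Function.comp_def]
    rw [Measure.map_id', Measure.map_id']
    exact Measure.AbsolutelyContinuous.add_left (withDensity_absolutelyContinuous _ _)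
      (withDensity_absolutelyContinuous _ _)
  exact hq.ae h

omit [Countable Y] [MeasurableSingletonClass Y] in
lemma ae_pairLaw_of_ae (ρ : Measure X) [IsProbabilityMeasure ρ] (π πsam : Policy X Y)
    {Q : X → Prop} (h : ∀ᵐ x ∂ρ, Q x) : ∀ᵐ p ∂(pairLaw ρ π πsam), Q p.1 := by
  have hq : Measure.QuasiMeasurePreserving (Prod.fst : X × Y × Y → X) (pairLaw ρ π πsam) ρ := by
    refine ⟨measurable_fst, ?_⟩
    have : (pairLaw ρ π πsam).map Prod.fst = ρ := Measure.fst_compProd _ _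
    rw [this]
  exact hq.ae h

omit [MeasurableSingletonClass Y] in
lemma ae_ne_zero_of_absolutelyContinuous {μ ν : Measure Y} (h : μ ≪ ν) :
    ∀ᵐ y ∂μ, ν {y} ≠ 0 := by
  rw [ae_iff]
  have : {y | ¬ ν {y} ≠ 0} = ⋃ y ∈ {y | ν {y} = 0}, {y} := by ext; simp
  rw [this]
  exact (measure_biUnion_null_iff (Set.to_countable _)).2 fun y hy => h hy

/-- Ensures that almost surely every collected response has positive reference mass, where the
implicit reward identity holds. -/
lemma ae_pairLaw_ne_zero (ρ : Measure X) [IsProbabilityMeasure ρ] {πref π πsam : Policy X Y}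
    (h : ∀ᵐ x ∂ρ, π.at x ≪ πref.at x) (hsam : ∀ᵐ x ∂ρ, πsam.at x ≪ πref.at x) :
    ∀ᵐ p ∂(pairLaw ρ π πsam), πref.at p.1 {p.2.1} ≠ 0 ∧ πref.at p.1 {p.2.2} ≠ 0 := by
  have hm : Measurable fun p : X × Y => πref.at p.1 {p.2} :=
    measurable_from_prod_countable_left fun y =>
      Kernel.measurable_coe πref.kernel (measurableSet_singleton y)
  have hm1 : Measurable fun p : X × Y × Y => πref.at p.1 {p.2.1} :=
    hm.comp (measurable_fst.prodMk measurable_snd.fst)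
  have hm2 : Measurable fun p : X × Y × Y => πref.at p.1 {p.2.2} :=
    hm.comp (measurable_fst.prodMk measurable_snd.snd)
  refine (Measure.ae_compProd_iff ?_).2 ?_
  · exact (hm1 (measurableSet_singleton 0).compl).inter (hm2 (measurableSet_singleton 0).compl)
  filter_upwards [h, hsam] with x hx hx2
  rw [Kernel.prod_apply]
  have a1 := Measure.quasiMeasurePreserving_fst (μ := π.kernel x) (ν := πsam.kernel x)
  have a2 := Measure.quasiMeasurePreserving_snd (μ := π.kernel x) (ν := πsam.kernel x)
  filter_upwards [a1.ae (ae_ne_zero_of_absolutelyContinuous hx),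
    a2.ae (ae_ne_zero_of_absolutelyContinuous hx2)] with y h1 h2
  exact ⟨h1, h2⟩

end RoundLaw

/-! ### Conditional laws along a run and Ville's inequality. -/

section Run

variable {X Y Ω : Type*} [MeasurableSpace X] [MeasurableSpace Y] [mΩ : MeasurableSpace Ω]
  {P : Measure Ω} [IsProbabilityMeasure P] {ℱ : Filtration ℕ mΩ} {T : ℕ}
  {ρ : Measure X} {β α γ : ℝ} {rstar : X → Y → ℝ} {πref πsam : Policy X Y}
  {𝒞 : Set (Policy X Y)} {π : ℕ → Ω → Policy X Y} {z : ℕ → Ω → Sample X Y}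

namespace IsRun

omit [IsProbabilityMeasure P] in
lemma mem_insert (h : IsRun P ℱ T ρ β α γ rstar πref πsam 𝒞 π z) {t : ℕ} (ht : t < T) (ω : Ω) :
    π t ω ∈ insert πref 𝒞 := by
  cases t with
  | zero => rw [h.init]; exact Set.mem_insert _ _
  | succ t => exact Set.mem_insert_of_mem _ (h.mem_class t ht ω)

omit [IsProbabilityMeasure P] in
/-- On an event of the past on which the policy is `p`, the comparison has law `roundLaw p`. -/
lemma setLIntegral_comp (h : IsRun P ℱ T ρ β α γ rstar πref πsam 𝒞 π z) {t : ℕ} (ht : t < T)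
    {S : Set Ω} (hS : MeasurableSet[ℱ t] S) (p : Policy X Y) (hp : ∀ ω ∈ S, π t ω = p)
    {f : Sample X Y → ℝ≥0∞} (hf : Measurable f) :
    ∫⁻ ω in S, f (z t ω) ∂P = P S * ∫⁻ s, f s ∂(roundLaw ρ rstar p πsam) := by
  have hz : Measurable (z t) := (h.adapted t ht).mono (ℱ.le _) le_rfl
  have hmap : (P.restrict S).map (z t) = P S • roundLaw ρ rstar p πsam := by
    ext A hA
    rw [Measure.map_apply hz hA, Measure.restrict_apply (hz hA), Set.inter_comm,
      h.condLaw t ht S hS A hA, setLIntegral_congr_fun (g := fun _ => roundLaw ρ rstar p πsam A)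
        (ℱ.le t _ hS) (fun ω hω => by simp only [hp ω hω])]
    rw [setLIntegral_const, mul_comm]
    rfl
  rw [← lintegral_map hf hz, hmap, lintegral_smul_measure]
  rfl

omit [IsProbabilityMeasure P] in
-- Extends the conditional law from events of the past to nonnegative functions of the past, by
-- monotone class, on the event where the policy is a fixed one.
lemma lintegral_mul_comp_of_eq (h : IsRun P ℱ T ρ β α γ rstar πref πsam 𝒞 π z) {t : ℕ}
    (ht : t < T) (p : Policy X Y) {f : Sample X Y → ℝ≥0∞} (hf : Measurable f) {G : Ω → ℝ≥0∞}
    (hG : Measurable[ℱ t] G) :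
    ∫⁻ ω, ({ω | π t ω = p}.indicator G ω) * f (z t ω) ∂P
      = ∫⁻ ω, ({ω | π t ω = p}.indicator G ω)
        * (∫⁻ s, f s ∂(roundLaw ρ rstar p πsam)) ∂P := by
  have hz : Measurable (z t) := (h.adapted t ht).mono (ℱ.le _) le_rfl
  have hfz : Measurable fun ω => f (z t ω) := hf.comp hz
  have hE := h.predictable t ht p
  refine @Measurable.ennreal_induction Ω (ℱ t) (fun G =>
    ∫⁻ ω, ({ω | π t ω = p}.indicator G ω) * f (z t ω) ∂P
      = ∫⁻ ω, ({ω | π t ω = p}.indicator G ω)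
        * (∫⁻ s, f s ∂(roundLaw ρ rstar p πsam)) ∂P) ?_ ?_ ?_ G hG
  · intro c S hS
    have hm := ℱ.le t _ (hE.inter hS)
    simp only [Set.indicator_indicator]
    have h1 : ∀ F : Ω → ℝ≥0∞, ∫⁻ ω, (({ω | π t ω = p} ∩ S).indicator (fun _ => c) ω) * F ω ∂P
        = ∫⁻ ω in {ω | π t ω = p} ∩ S, c * F ω ∂P := by
      intro F
      rw [← lintegral_indicator hm]
      refine lintegral_congr fun ω => ?_
      by_cases hω : ω ∈ {ω | π t ω = p} ∩ S <;> simp [hω]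
    rw [h1, h1, lintegral_const_mul _ hfz,
      h.setLIntegral_comp ht (hE.inter hS) p (fun ω hω => hω.1) hf, setLIntegral_const]
    ring
  · intro G₁ G₂ _ hG₁ hG₂ e₁ e₂
    have hm : Measurable ({ω | π t ω = p}.indicator G₁) :=
      (hG₁.mono (ℱ.le t) le_rfl).indicator (ℱ.le t _ hE)
    have hm1 : Measurable fun ω => {ω | π t ω = p}.indicator G₁ ω * f (z t ω) := hm.mul hfz
    simp only [Set.indicator_add', Pi.add_apply, add_mul]
    rw [lintegral_add_left hm1, lintegral_add_left (hm.mul_const _), e₁, e₂]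
  · intro F hF hmono e
    have hm : ∀ n, Measurable ({ω | π t ω = p}.indicator (F n)) := fun n =>
      ((hF n).mono (ℱ.le t) le_rfl).indicator (ℱ.le t _ hE)
    have hind : ∀ ω, {ω | π t ω = p}.indicator (fun ω => ⨆ n, F n ω) ω
        = ⨆ n, {ω | π t ω = p}.indicator (F n) ω := by
      intro ω
      by_cases hω : ω ∈ {ω | π t ω = p} <;> simp [Set.indicator, hω]
    have hmi : ∀ ω, Monotone fun n => {ω | π t ω = p}.indicator (F n) ω := by
      intro ω m n hmn
      exact Set.indicator_le_indicator (hmono hmn ω)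
    simp only [hind, ENNReal.iSup_mul]
    have hm1 : ∀ n, Measurable fun ω => {ω | π t ω = p}.indicator (F n) ω * f (z t ω) :=
      fun n => (hm n).mul hfz
    rw [lintegral_iSup hm1
        (fun m n hmn ω => mul_le_mul_left (hmi ω hmn) _),
      lintegral_iSup (fun n => (hm n).mul_const _)
        (fun m n hmn ω => mul_le_mul_left (hmi ω hmn) _)]
    exact iSup_congr e

omit [IsProbabilityMeasure P] in
/-- The conditional law of a comparison, integrated against a function of the past. -/
lemma lintegral_mul_comp (h : IsRun P ℱ T ρ β α γ rstar πref πsam 𝒞 π z) (h𝒞 : 𝒞.Finite)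
    {t : ℕ} (ht : t < T) {f : Policy X Y → Sample X Y → ℝ≥0∞} (hf : ∀ p, Measurable (f p))
    {G : Ω → ℝ≥0∞} (hG : Measurable[ℱ t] G) :
    ∫⁻ ω, G ω * f (π t ω) (z t ω) ∂P
      = ∫⁻ ω, G ω * ∫⁻ s, f (π t ω) s ∂(roundLaw ρ rstar (π t ω) πsam) ∂P := by
  classical
  have hz : Measurable (z t) := (h.adapted t ht).mono (ℱ.le _) le_rfl
  -- A run only plays `πref` and members of the finite class, so expectations split into a finite
  -- sum over the value of `π t`; no measurable structure on policies is needed.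
  set S := (h𝒞.insert πref).toFinset
  have hsum : ∀ F : Policy X Y → Ω → ℝ≥0∞, ∀ ω, G ω * F (π t ω) ω
      = ∑ p ∈ S, {ω | π t ω = p}.indicator G ω * F p ω := by
    intro F ω
    rw [Finset.sum_eq_single (π t ω)]
    · simp [Set.indicator]
    · intro p _ hp
      simp [Set.indicator, hp.symm]
    · intro hn
      exact absurd ((h𝒞.insert πref).mem_toFinset.2 (h.mem_insert ht ω)) hn
  have hm : ∀ p, Measurable ({ω | π t ω = p}.indicator G) := fun p =>
    (hG.mono (ℱ.le t) le_rfl).indicator (ℱ.le t _ (h.predictable t ht p))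
  have hm1 : ∀ p, Measurable fun ω => {ω | π t ω = p}.indicator G ω * f p (z t ω) := fun p =>
    (hm p).mul ((hf p).comp hz)
  rw [lintegral_congr (hsum fun p ω => f p (z t ω)),
    lintegral_congr (hsum fun p _ => ∫⁻ s, f p s ∂(roundLaw ρ rstar p πsam)),
    lintegral_finsetSum _ fun p _ => hm1 p,
    lintegral_finsetSum _ fun p _ => (hm p).mul_const _]
  exact Finset.sum_congr rfl fun p _ => h.lintegral_mul_comp_of_eq ht p (hf p) hG

omit [IsProbabilityMeasure P] in
lemma measurable_comp (h : IsRun P ℱ T ρ β α γ rstar πref πsam 𝒞 π z) (h𝒞 : 𝒞.Finite)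
    {t : ℕ} (ht : t < T) {f : Policy X Y → Sample X Y → ℝ≥0∞} (hf : ∀ p, Measurable (f p)) :
    Measurable[ℱ (t + 1)] fun ω => f (π t ω) (z t ω) := by
  classical
  have hsum : (fun ω => f (π t ω) (z t ω)) = fun ω => ∑ p ∈ (h𝒞.insert πref).toFinset,
      {ω | π t ω = p}.indicator (fun ω => f p (z t ω)) ω := by
    ext ω
    rw [Finset.sum_eq_single (π t ω)]
    · simp [Set.indicator]
    · intro p _ hp
      simp [Set.indicator, hp.symm]
    · intro hn
      exact absurd ((h𝒞.insert πref).mem_toFinset.2 (h.mem_insert ht ω)) hn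
  rw [hsum]
  refine Finset.measurable_sum _ fun p _ => ?_
  exact ((hf p).comp (h.adapted t ht)).indicator
    (ℱ.mono (Nat.le_succ t) _ (h.predictable t ht p))

omit [IsProbabilityMeasure P] in
lemma ae_comp (h : IsRun P ℱ T ρ β α γ rstar πref πsam 𝒞 π z) (h𝒞 : 𝒞.Finite)
    {t : ℕ} (ht : t < T) {Q : Sample X Y → Prop}
    (hQ : ∀ p ∈ insert πref 𝒞, ∀ᵐ s ∂(roundLaw ρ rstar p πsam), Q s) :
    ∀ᵐ ω ∂P, Q (z t ω) := by
  -- `Q` is not assumed measurable, so its failure set is replaced by a measurable hull of the same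
  -- measure.
  set A : Policy X Y → Set (Sample X Y) := fun p =>
    toMeasurable (roundLaw ρ rstar p πsam) {s | ¬ Q s}
  have hA : ∀ p, MeasurableSet (A p) := fun p => measurableSet_toMeasurable _ _
  have hf : ∀ p, Measurable ((A p).indicator fun _ => (1 : ℝ≥0∞)) := fun p =>
    measurable_const.indicator (hA p)
  have h1 := h.lintegral_mul_comp h𝒞 ht hf (G := fun _ => 1) measurable_const
  have h2 : ∀ ω, (1 : ℝ≥0∞) * ∫⁻ s, (A (π t ω)).indicator (fun _ => 1) s
      ∂(roundLaw ρ rstar (π t ω) πsam) = 0 := by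
    intro ω
    rw [one_mul, lintegral_indicator_const (hA _), measure_toMeasurable, one_mul]
    exact hQ _ (h.mem_insert ht ω)
  rw [lintegral_congr h2, lintegral_zero] at h1
  have hm : Measurable fun ω => (1 : ℝ≥0∞) * (A (π t ω)).indicator (fun _ => 1) (z t ω) :=
    measurable_const.mul ((h.measurable_comp h𝒞 ht hf).mono (ℱ.le _) le_rfl)
  filter_upwards [(lintegral_eq_zero_iff hm).1 h1] with ω hω
  by_contra hn
  have : z t ω ∈ A (π t ω) := subset_toMeasurable _ _ hn
  simp [this] at hω

/-- Ville's inequality for a product of conditionally subnormalized factors. -/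
lemma ville (h : IsRun P ℱ T ρ β α γ rstar πref πsam 𝒞 π z) (h𝒞 : 𝒞.Finite)
    {f : Policy X Y → Sample X Y → ℝ≥0∞} (hf : ∀ p, Measurable (f p))
    (hf1 : ∀ p, ∫⁻ s, f p s ∂(roundLaw ρ rstar p πsam) ≤ 1) (a : ℝ≥0∞) :
    a * P {ω | ∃ t ≤ T, a ≤ ∏ s ∈ Finset.range t, f (π s ω) (z s ω)} ≤ 1 := by
  set M : ℕ → Ω → ℝ≥0∞ := fun t ω => ∏ s ∈ Finset.range t, f (π s ω) (z s ω) with hM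
  have hMm : ∀ t ≤ T, Measurable[ℱ t] (M t) := by
    intro t ht
    refine Finset.measurable_prod _ fun s hs => ?_
    have hs' := Finset.mem_range.1 hs
    exact (h.measurable_comp h𝒞 (by omega) hf).mono (ℱ.mono hs') le_rfl
  set B : ℕ → Set Ω := fun t => {ω | ∃ s ≤ t, a ≤ M s ω} with hB
  have hBs : ∀ t, B (t + 1) = B t ∪ {ω | a ≤ M (t + 1) ω} := by
    intro t
    ext ω
    simp only [hB, Set.mem_ofPred_eq, Set.mem_union]
    constructor
    · rintro ⟨s, hs, hle⟩
      rcases Nat.le_succ_iff.1 hs with h1 | h1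
      · exact Or.inl ⟨s, h1, hle⟩
      · subst h1; exact Or.inr hle
    · rintro (⟨s, hs, hle⟩ | hle)
      · exact ⟨s, by omega, hle⟩
      · exact ⟨t + 1, le_rfl, hle⟩
  have hset : ∀ t ≤ T, MeasurableSet[ℱ t] {ω | a ≤ M t ω} := fun t ht =>
    (hMm t ht) measurableSet_Ici
  have hBm : ∀ t ≤ T, MeasurableSet[ℱ t] (B t) := by
    intro t
    induction t with
    | zero =>
      intro ht
      convert hset 0 ht using 1
      ext ω; simp [hB]
    | succ t ih =>
      intro ht
      rw [hBs]
      exact (ℱ.mono (Nat.le_succ t) _ (ih (by omega))).union (hset _ ht)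
  -- Ville without stopping times: `B t` collects the paths that have crossed level `a`. On its
  -- complement the mean of `M` does not increase, and the paths crossing at the next step carry
  -- mass at least `a` times their probability.
  have key : ∀ t ≤ T, a * P (B t) + ∫⁻ ω in (B t)ᶜ, M t ω ∂P ≤ 1 := by
    intro t
    induction t with
    | zero =>
      intro _
      have hM0 : ∀ ω, M 0 ω = 1 := fun ω => by simp [hM]
      simp only [hM0, setLIntegral_const, one_mul]
      by_cases ha : a ≤ 1
      · have : B 0 = Set.univ := by ext ω; simp [hB, hM0, ha]
        rw [this]; simpa using ha
      · have : B 0 = ∅ := by ext ω; simp [hB, hM0]; exact not_le.1 ha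
        rw [this]; simp
    | succ t ih =>
      intro ht
      have ih := ih (by omega)
      have hBt := hBm t (by omega)
      have hstep : ∫⁻ ω in (B t)ᶜ, M (t + 1) ω ∂P ≤ ∫⁻ ω in (B t)ᶜ, M t ω ∂P := by
        rw [← lintegral_indicator (ℱ.le t _ hBt.compl), ← lintegral_indicator (ℱ.le t _ hBt.compl)]
        have hGm : Measurable[ℱ t] ((B t)ᶜ.indicator (M t)) :=
          (hMm t (by omega)).indicator hBt.compl
        have e := h.lintegral_mul_comp h𝒞 (t := t) (by omega) hf hGm
        calc _ = ∫⁻ ω, (B t)ᶜ.indicator (M t) ω * f (π t ω) (z t ω) ∂P := by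
              refine lintegral_congr fun ω => ?_
              by_cases hω : ω ∈ (B t)ᶜ
              · simp only [Set.indicator_of_mem hω, hM, Finset.prod_range_succ]
              · simp only [Set.indicator_of_notMem hω, zero_mul]
          _ ≤ ∫⁻ ω, (B t)ᶜ.indicator (M t) ω * 1 ∂P := by
              rw [e]
              exact lintegral_mono fun ω => mul_le_mul_right (hf1 _) _
          _ = _ := by simp
      have hBc : (B t)ᶜ = ((B (t + 1)) \ B t) ∪ (B (t + 1))ᶜ := by
        rw [hBs]; ext ω; simp only [Set.mem_union, Set.mem_compl_iff, Set.mem_sdiff]; tauto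
      have hBm1 := ℱ.le _ _ (hBm (t + 1) ht)
      have hBm0 := ℱ.le _ _ hBt
      have hsub : B t ⊆ B (t + 1) := by rw [hBs]; exact Set.subset_union_left
      have hsplit : ∫⁻ ω in (B t)ᶜ, M (t + 1) ω ∂P
          = ∫⁻ ω in B (t + 1) \ B t, M (t + 1) ω ∂P + ∫⁻ ω in (B (t + 1))ᶜ, M (t + 1) ω ∂P := by
        conv_lhs => rw [hBc]
        refine lintegral_union hBm1.compl ?_
        exact Set.disjoint_left.2 fun ω h1 h2 => h2 h1.1
      have hge : a * P (B (t + 1) \ B t) ≤ ∫⁻ ω in B (t + 1) \ B t, M (t + 1) ω ∂P := by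
        rw [← setLIntegral_const]
        refine setLIntegral_mono' (hBm1.diff hBm0) fun ω hω => ?_
        have h1 := hω.1
        rw [hBs] at h1
        exact h1.resolve_left hω.2
      have hP : P (B (t + 1)) = P (B t) + P (B (t + 1) \ B t) := by
        rw [measure_add_sdiff hBm0.nullMeasurableSet, Set.union_eq_self_of_subset_left hsub]
      calc a * P (B (t + 1)) + ∫⁻ ω in (B (t + 1))ᶜ, M (t + 1) ω ∂P
          ≤ a * P (B t) + (∫⁻ ω in B (t + 1) \ B t, M (t + 1) ω ∂P
            + ∫⁻ ω in (B (t + 1))ᶜ, M (t + 1) ω ∂P) := by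
            rw [hP, mul_add, add_assoc]; gcongr
        _ ≤ a * P (B t) + ∫⁻ ω in (B t)ᶜ, M t ω ∂P := by rw [← hsplit]; gcongr
        _ ≤ 1 := ih
  exact le_self_add.trans (key T le_rfl)

end IsRun

end Run

/-! ### Uniform concentration of likelihoods; the DPO loss as a likelihood. -/

section Concentration

variable {X Y Ω : Type*} [MeasurableSpace X] [MeasurableSpace Y] [Countable Y]
  [MeasurableSingletonClass Y] [mΩ : MeasurableSpace Ω]
  {P : Measure Ω} [IsProbabilityMeasure P] {ℱ : Filtration ℕ mΩ} {T : ℕ}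
  {ρ : Measure X} [IsProbabilityMeasure ρ] {β α γ B : ℝ} {rstar : X → Y → ℝ}
  {πref πsam : Policy X Y} {𝒞 : Set (Policy X Y)} {π : ℕ → Ω → Policy X Y}
  {z : ℕ → Ω → Sample X Y} {R : Finset (X → Y → ℝ)}

/-- With probability at least `1 - δ`, uniformly in the reward and the round, the likelihood of a
reward exceeds that of the true one only by the confidence level minus the information gained. -/
theorem IsRun.measure_exists_logLik_gt_le (h : IsRun P ℱ T ρ β α γ rstar πref πsam 𝒞 π z)
    (h𝒞 : 𝒞.Finite) (hR : ∀ r ∈ R, ∀ y, Measurable fun x => r x y) (hs : rstar ∈ R) {δ : ℝ}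
    (hδ : 0 < δ) :
    P {ω | ∃ r ∈ R, ∃ t ≤ T, Real.log (R.card / δ) < ∑ s ∈ Finset.range t,
      ((logLik r (z s ω) - logLik rstar (z s ω)) / 2
        + hellingerGap ρ r rstar (π s ω) πsam)} ≤ ENNReal.ofReal δ := by
  have hcard : (0 : ℝ) < R.card := by exact_mod_cast Finset.card_pos.2 ⟨_, hs⟩
  set a : ℝ := R.card / δ with ha
  have hapos : 0 < a := div_pos hcard hδ
  set f : (X → Y → ℝ) → Policy X Y → Sample X Y → ℝ≥0∞ := fun r p s =>
    ENNReal.ofReal (Real.exp ((logLik r s - logLik rstar s) / 2 + hellingerGap ρ r rstar p πsam))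
  have hsub : {ω | ∃ r ∈ R, ∃ t ≤ T, Real.log a < ∑ s ∈ Finset.range t,
      ((logLik r (z s ω) - logLik rstar (z s ω)) / 2
        + hellingerGap ρ r rstar (π s ω) πsam)}
      ⊆ ⋃ r ∈ R, {ω | ∃ t ≤ T, ENNReal.ofReal a
        ≤ ∏ s ∈ Finset.range t, f r (π s ω) (z s ω)} := by
    rintro ω ⟨r, hr, t, ht, hlt⟩
    simp only [Set.mem_iUnion]
    refine ⟨r, hr, t, ht, ?_⟩
    rw [← ENNReal.ofReal_prod_of_nonneg fun _ _ => (Real.exp_pos _).le, ← Real.exp_sum]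
    refine ENNReal.ofReal_le_ofReal ?_
    rw [← Real.exp_log hapos]
    exact Real.exp_le_exp.2 hlt.le
  have hone : ∀ r ∈ R, P {ω | ∃ t ≤ T, ENNReal.ofReal a
        ≤ ∏ s ∈ Finset.range t, f r (π s ω) (z s ω)} ≤ (ENNReal.ofReal a)⁻¹ := by
    intro r hr
    have hf : ∀ p, Measurable (f r p) := fun p =>
      (((((measurable_logLik (hR r hr)).sub (measurable_logLik (hR _ hs))).div_const 2).add_const
        _).exp).ennreal_ofReal
    have hv := h.ville h𝒞 hf (fun p => lintegral_exp_logLik_le (hR r hr) (hR _ hs) ρ p πsam)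
      (ENNReal.ofReal a)
    rw [ENNReal.le_inv_iff_mul_le, mul_comm]
    exact hv
  calc _ ≤ ∑ r ∈ R, P {ω | ∃ t ≤ T, ENNReal.ofReal a
        ≤ ∏ s ∈ Finset.range t, f r (π s ω) (z s ω)} :=
        (measure_mono hsub).trans (measure_biUnion_finset_le _ _)
    _ ≤ ∑ _r ∈ R, (ENNReal.ofReal a)⁻¹ := Finset.sum_le_sum hone
    _ = ENNReal.ofReal δ := by
        rw [Finset.sum_const, nsmul_eq_mul, ← ENNReal.ofReal_inv_of_pos hapos,
          ← ENNReal.ofReal_natCast, ← ENNReal.ofReal_mul hcard.le]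
        congr 1
        rw [ha, inv_div]
        field_simp

omit [IsProbabilityMeasure P] in
/-- Almost surely, the losses of the regularized optimal policies on the collected data are the
negative log-likelihoods of their rewards. -/
theorem IsRun.ae_dpoLoss_eq {πreg : (X → Y → ℝ) → Policy X Y}
    (h : IsRun P ℱ T ρ β α γ rstar πref πsam (πreg '' (R : Set (X → Y → ℝ))) π z)
    (hsam : ∀ᵐ x ∂ρ, πsam.at x ≪ πref.at x)
    (hR : ∀ r ∈ R, IsBoundedReward ρ r B) (hβ : 0 < β)
    (hreg : ∀ r (hr : r ∈ R), ∀ᵐ x ∂ρ, (πreg r).at x = (gibbs (hR r hr) hβ πref).at x) :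
    ∀ᵐ ω ∂P, ∀ r ∈ R, ∀ n ≤ T, dpoLoss β πref (πreg r) (fun s => z s ω) n
      = -∑ s ∈ Finset.range n, logLik r (z s ω) := by
  have hac : ∀ p ∈ insert πref (πreg '' (R : Set (X → Y → ℝ))),
      ∀ᵐ x ∂ρ, p.at x ≪ πref.at x := by
    rintro p (rfl | ⟨r, hr, rfl⟩)
    · exact Filter.Eventually.of_forall fun x => Measure.AbsolutelyContinuous.rfl
    · filter_upwards [hreg r hr] with x hx
      rw [hx]
      exact gibbs_absolutelyContinuous (hR r hr) hβ πref x
  have hall : ∀ᵐ x ∂ρ, ∀ r, ∀ hr : r ∈ R, (πreg r).at x = (gibbs (hR r hr) hβ πref).at x := by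
    have h2 : ∀ᵐ x ∂ρ, ∀ r : R, (πreg r.1).at x = (gibbs (hR r.1 r.2) hβ πref).at x :=
      ae_all_iff.2 fun r => hreg r.1 r.2
    filter_upwards [h2] with x hx r hr using hx ⟨r, hr⟩
  have hgood : ∀ t < T, ∀ᵐ ω ∂P,
      (∀ r, ∀ hr : r ∈ R, (πreg r).at (z t ω).1.1 = (gibbs (hR r hr) hβ πref).at (z t ω).1.1)
      ∧ πref.at (z t ω).1.1 {(z t ω).1.2.1} ≠ 0 ∧ πref.at (z t ω).1.1 {(z t ω).1.2.2} ≠ 0 := by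
    intro t ht
    refine h.ae_comp (R.finite_toSet.image _) ht (Q := fun s =>
      (∀ r, ∀ hr : r ∈ R, (πreg r).at s.1.1 = (gibbs (hR r hr) hβ πref).at s.1.1)
      ∧ πref.at s.1.1 {s.1.2.1} ≠ 0 ∧ πref.at s.1.1 {s.1.2.2} ≠ 0) fun p hp => ?_
    exact ae_roundLaw_of_ae_pairLaw (Q := fun q : X × Y × Y =>
      (∀ r, ∀ hr : r ∈ R, (πreg r).at q.1 = (gibbs (hR r hr) hβ πref).at q.1)
      ∧ πref.at q.1 {q.2.1} ≠ 0 ∧ πref.at q.1 {q.2.2} ≠ 0) ρ p πsam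
      ((ae_pairLaw_of_ae ρ p πsam hall).and (ae_pairLaw_ne_zero ρ (hac p hp) hsam))
  have hgood' : ∀ᵐ ω ∂P, ∀ t < T,
      (∀ r, ∀ hr : r ∈ R, (πreg r).at (z t ω).1.1 = (gibbs (hR r hr) hβ πref).at (z t ω).1.1)
      ∧ πref.at (z t ω).1.1 {(z t ω).1.2.1} ≠ 0 ∧ πref.at (z t ω).1.1 {(z t ω).1.2.2} ≠ 0 :=
    ae_all_iff.2 fun t => by
      by_cases ht : t < T
      · filter_upwards [hgood t ht] with ω hω _ using hω
      · exact Filter.Eventually.of_forall fun ω h => absurd h ht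
  filter_upwards [hgood'] with ω hω r hr n hn
  unfold dpoLoss logLik
  refine congrArg Neg.neg (Finset.sum_congr rfl fun s hs => ?_)
  obtain ⟨hx, h1, h2⟩ := hω s (by have := Finset.mem_range.1 hs; omega)
  -- The soft value depends only on the prompt and cancels between winner and loser.
  have e1 := mul_logRatio_of_at_eq_gibbs (hR r hr) hβ (hx r hr) h1
  have e2 := mul_logRatio_of_at_eq_gibbs (hR r hr) hβ (hx r hr) h2
  congr 2
  unfold Sample.prompt Sample.winner Sample.loser
  cases (z s ω).2
  · simp only [Bool.false_eq_true, if_false]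
    rw [e1, e2]; ring
  · simp only [if_true]
    rw [e1, e2]; ring

end Concentration

/-! ### Decomposition of the regret of one round. -/

section RoundRegret

variable {X Y : Type*} [MeasurableSpace X] [MeasurableSpace Y] [Countable Y]
  [MeasurableSingletonClass Y] {ρ : Measure X} [IsProbabilityMeasure ρ] {β B : ℝ}
  {r rstar : X → Y → ℝ} {πref πsam π πstar : Policy X Y}

omit [Countable Y] [MeasurableSingletonClass Y] in
lemma integral_pairLaw (π π' : Policy X Y) {F : X × Y × Y → ℝ}
    (hF : Integrable F (pairLaw ρ π π')) :
    ∫ p, F p ∂(pairLaw ρ π π') = ∫ x, ∫ y, ∫ y', F (x, y, y') ∂(π'.at x) ∂(π.at x) ∂ρ := by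
  have h1 := (Measure.integrable_compProd_iff hF.aestronglyMeasurable).1 hF
  unfold pairLaw at hF ⊢
  rw [Measure.integral_compProd hF]
  refine integral_congr_ae ?_
  filter_upwards [h1.1] with x hx
  rw [Kernel.prod_apply] at hx ⊢
  exact integral_prod _ hx

omit [Countable Y] [MeasurableSingletonClass Y] in
lemma integrable_pairLaw_of_prompt (π π' : Policy X Y) {F : X → ℝ} (hF : Integrable F ρ) :
    Integrable (fun p : X × Y × Y => F p.1) (pairLaw ρ π π') ∧
    ∫ p, F p.1 ∂(pairLaw ρ π π') = ∫ x, F x ∂ρ := by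
  have hfst : (pairLaw ρ π π').map Prod.fst = ρ := Measure.fst_compProd _ _
  have hF' : Integrable F ((pairLaw ρ π π').map Prod.fst) := by rwa [hfst]
  refine ⟨hF'.comp_measurable measurable_fst, ?_⟩
  rw [← integral_map (f := F) measurable_fst.aemeasurable hF'.aestronglyMeasurable, hfst]

lemma integrable_pairLaw_reward (hr : IsBoundedReward ρ r B) (π π' : Policy X Y) :
    Integrable (fun p : X × Y × Y => r p.1 p.2.1) (pairLaw ρ π π') ∧
    ∫ p, r p.1 p.2.1 ∂(pairLaw ρ π π') = expReward ρ r π := by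
  obtain ⟨y₀⟩ := ρ.nonempty_response π
  have hm : Measurable fun p : X × Y × Y => r p.1 p.2.1 :=
    hr.measurable_uncurry.comp (measurable_fst.prodMk measurable_snd.fst)
  have h0 := (integrable_pairLaw_of_prompt π π' (hr.integrable y₀)).1
  have hi : Integrable (fun p : X × Y × Y => r p.1 p.2.1) (pairLaw ρ π π') := by
    have h1 : Integrable (fun p : X × Y × Y => r p.1 p.2.1 - r p.1 y₀) (pairLaw ρ π π') :=
      integrable_of_bounded (hm.sub ((hr.measurable y₀).comp measurable_fst)) B
        fun p => hr.abs_sub_le _ _ _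
    exact (h1.add h0).congr (Filter.Eventually.of_forall fun p => by simp)
  refine ⟨hi, ?_⟩
  rw [integral_pairLaw π π' hi]
  simp [expReward]

lemma integrable_sigmoid {Z : Type*} [MeasurableSpace Z] {μ : Measure Z} [IsFiniteMeasure μ]
    {f : Z → ℝ} (hf : Measurable f) : Integrable (fun z => Real.sigmoid (f z)) μ :=
  integrable_of_bounded (continuous_sigmoid.measurable.comp hf) 1 fun z => by
    rw [abs_of_nonneg (Real.sigmoid_nonneg _)]; exact Real.sigmoid_le_one _

/-- The lightweight bonus of a regularized optimal policy, as a function of its reward. -/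
lemma lightBonus_eq (hr : IsBoundedReward ρ r B) (hβ : 0 < β)
    (hsam : ∀ᵐ x ∂ρ, πsam.at x ≪ πref.at x)
    (hπ : ∀ᵐ x ∂ρ, π.at x = (gibbs hr hβ πref).at x) (π' : Policy X Y) :
    Integrable (fun p => Real.sigmoid (softValue β πref r p.1 - r p.1 p.2.2))
      (pairLaw ρ π' πsam) ∧
    lightBonus ρ β πref πsam π
      = ∫ p, Real.sigmoid (softValue β πref r p.1 - r p.1 p.2.2) ∂(pairLaw ρ π' πsam) := by
  have hm : Measurable fun p : X × Y × Y => softValue β πref r p.1 - r p.1 p.2.2 :=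
    ((hr.measurable_softValue πref).comp measurable_fst).sub
      (hr.measurable_uncurry.comp (measurable_fst.prodMk measurable_snd.snd))
  refine ⟨integrable_sigmoid hm, ?_⟩
  rw [integral_pairLaw π' πsam (integrable_sigmoid hm)]
  unfold lightBonus
  refine integral_congr_ae ?_
  filter_upwards [hsam, hπ] with x hx hx2
  -- The integrand ignores the first response, so its law `π'` is free; this lets one bonus be
  -- coupled with `πstar` and the other with `π`.
  simp only [integral_const, probReal_univ, one_smul]
  refine integral_congr_ae ?_
  filter_upwards [ae_ne_zero_of_absolutelyContinuous hx] with y hy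
  rw [mul_logRatio_of_at_eq_gibbs hr hβ hx2 hy, neg_sub]

/-- Passage from `a` to `c` through a common upper bound; below, `b` involves the reward supremum,
and `b - c` is a regularization or suboptimality gap. -/
lemma sigmoid_le_add_sub {a b c : ℝ} (hab : a ≤ b) (hcb : c ≤ b) :
    Real.sigmoid a ≤ Real.sigmoid c + (b - c) := by
  have h1 := Real.sigmoid_le hab
  have h2 := (abs_le.1 (abs_sigmoid_sub_le b c)).2
  rw [abs_of_nonneg (by linarith)] at h2
  linarith

lemma roundRegret_eq (hs : ∀ y, Measurable fun x => rstar x y) :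
    ∫ x, ∫ ystar, ∫ y, ∫ y', (pref rstar x ystar y' - pref rstar x y y')
      ∂(πsam.at x) ∂(π.at x) ∂(πstar.at x) ∂ρ
      = ∫ p, Real.sigmoid (rewardDiff rstar p) ∂(pairLaw ρ πstar πsam)
        - ∫ p, Real.sigmoid (rewardDiff rstar p) ∂(pairLaw ρ π πsam) := by
  have hi : ∀ π : Policy X Y, Integrable (fun p => Real.sigmoid (rewardDiff rstar p))
      (pairLaw ρ π πsam) := fun π => integrable_sigmoid (measurable_rewardDiff hs)
  have hI : ∀ π : Policy X Y, Integrable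
      (fun x => ∫ y, ∫ y', pref rstar x y y' ∂(πsam.at x) ∂(π.at x)) ρ := by
    intro π
    have h1 := (hi π).integral_compProd
    refine h1.congr (Filter.Eventually.of_forall fun x => ?_)
    dsimp only
    rw [Kernel.prodMkLeft_apply, Kernel.prod_apply]
    exact integral_prod (fun q => Real.sigmoid (rewardDiff rstar (x, q)))
      (integrable_sigmoid ((measurable_rewardDiff hs).comp measurable_prodMk_left))
  rw [integral_pairLaw _ _ (hi πstar), integral_pairLaw _ _ (hi π)]
  refine Eq.trans ?_ (integral_sub (hI πstar) (hI π))
  refine integral_congr_ae (Filter.Eventually.of_forall fun x => ?_)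
  dsimp only
  have hb : ∀ (μ : Measure Y) [IsProbabilityMeasure μ] (g : Y → ℝ), (∀ y, 0 ≤ g y) →
      (∀ y, g y ≤ 1) → Integrable g μ := fun μ _ g h0 h1 =>
    integrable_of_bounded Measurable.of_discrete 1 fun y => by
      rw [abs_of_nonneg (h0 y)]; exact h1 y
  have hp : ∀ y, Integrable (fun y' => pref rstar x y y') (πsam.at x) := fun y =>
    hb _ _ (fun _ => Real.sigmoid_nonneg _) fun _ => Real.sigmoid_le_one _
  have hq : ∀ (μ : Measure Y) [IsProbabilityMeasure μ],
      Integrable (fun y => ∫ y', pref rstar x y y' ∂(πsam.at x)) μ := fun μ _ =>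
    hb _ _ (fun _ => integral_nonneg fun _ => Real.sigmoid_nonneg _) fun y => by
      calc _ ≤ ∫ _, (1 : ℝ) ∂(πsam.at x) :=
            integral_mono (hp y) (integrable_const _) fun _ => Real.sigmoid_le_one _
        _ = 1 := by simp
  have e1 : ∀ ystar y, ∫ y', (pref rstar x ystar y' - pref rstar x y y') ∂(πsam.at x)
      = ∫ y', pref rstar x ystar y' ∂(πsam.at x) - ∫ y', pref rstar x y y' ∂(πsam.at x) :=
    fun ystar y => integral_sub (hp ystar) (hp y)
  simp only [e1]
  have e2 : ∀ ystar, ∫ y, (∫ y', pref rstar x ystar y' ∂(πsam.at x)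
        - ∫ y', pref rstar x y y' ∂(πsam.at x)) ∂(π.at x)
      = ∫ y', pref rstar x ystar y' ∂(πsam.at x)
        - ∫ y, ∫ y', pref rstar x y y' ∂(πsam.at x) ∂(π.at x) := by
    intro ystar
    rw [integral_sub (integrable_const _) (hq _)]; simp
  simp only [e2]
  rw [integral_sub (hq _) (integrable_const _), integral_const, probReal_univ, one_smul]
  rfl

/-- Needed for the first round, where the reference policy is played without being known to lie in
the class. -/
lemma roundRegret_le_one (hs : ∀ y, Measurable fun x => rstar x y) :
    ∫ x, ∫ ystar, ∫ y, ∫ y', (pref rstar x ystar y' - pref rstar x y y')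
      ∂(πsam.at x) ∂(π.at x) ∂(πstar.at x) ∂ρ ≤ 1 := by
  rw [roundRegret_eq hs]
  have h1 : ∫ p, Real.sigmoid (rewardDiff rstar p) ∂(pairLaw ρ πstar πsam) ≤ 1 := by
    calc _ ≤ ∫ _, (1 : ℝ) ∂(pairLaw ρ πstar πsam) :=
          integral_mono (integrable_sigmoid (measurable_rewardDiff hs)) (integrable_const _)
            fun _ => Real.sigmoid_le_one _
      _ = 1 := by simp
  have h2 : 0 ≤ ∫ p, Real.sigmoid (rewardDiff rstar p) ∂(pairLaw ρ π πsam) :=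
    integral_nonneg fun _ => Real.sigmoid_nonneg _
  linarith

/-- The regret of a round is controlled by the regularization gaps, the bonus difference and the
error of the preference model on the data distribution. -/
theorem roundRegret_le (hr : IsBoundedReward ρ r B) (hs : IsBoundedReward ρ rstar B) (hβ : 0 < β)
    (hsam : ∀ᵐ x ∂ρ, πsam.at x ≪ πref.at x)
    (hπ : ∀ᵐ x ∂ρ, π.at x = (gibbs hr hβ πref).at x) {πs : Policy X Y}
    (hπs : ∀ᵐ x ∂ρ, πs.at x = (gibbs hs hβ πref).at x) :
    ∫ x, ∫ ystar, ∫ y, ∫ y', (pref rstar x ystar y' - pref rstar x y y')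
      ∂(πsam.at x) ∂(π.at x) ∂(πstar.at x) ∂ρ
      ≤ (∫ x, rewardSup rstar x ∂ρ - ∫ x, softValue β πref rstar x ∂ρ)
        + (∫ x, rewardSup r x ∂ρ - ∫ x, softValue β πref r x ∂ρ)
        + (lightBonus ρ β πref πsam πs - lightBonus ρ β πref πsam π)
        + ∫ p, |Real.sigmoid (rewardDiff r p) - Real.sigmoid (rewardDiff rstar p)|
          ∂(pairLaw ρ π πsam) := by
  have := ρ.nonempty_response π
  rw [roundRegret_eq hs.measurable]
  obtain ⟨i1, e1⟩ := lightBonus_eq hs hβ hsam hπs πstar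
  obtain ⟨i2, e2⟩ := lightBonus_eq hr hβ hsam hπ π
  obtain ⟨i3, e3⟩ := integrable_pairLaw_of_prompt πstar πsam hs.integrable_rewardSup
  obtain ⟨i4, e4⟩ := integrable_pairLaw_of_prompt πstar πsam (hs.integrable_softValue hβ πref)
  obtain ⟨i5, e5⟩ := integrable_pairLaw_of_prompt π πsam hr.integrable_rewardSup
  obtain ⟨i6, e6⟩ := integrable_pairLaw_reward hr π πsam
  have i34 : Integrable (fun p : X × Y × Y => rewardSup rstar p.1 - softValue β πref rstar p.1)
      (pairLaw ρ πstar πsam) := i3.sub i4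
  have i56 : Integrable (fun p : X × Y × Y => rewardSup r p.1 - r p.1 p.2.1)
      (pairLaw ρ π πsam) := i5.sub i6
  have j : ∀ (π : Policy X Y) {r : X → Y → ℝ}, IsBoundedReward ρ r B →
      Integrable (fun p => Real.sigmoid (rewardDiff r p)) (pairLaw ρ π πsam) := fun π r hr =>
    integrable_sigmoid (measurable_rewardDiff hr.measurable)
  -- Optimism: the value of the comparator is at most the bonus of `π(r⋆)`, up to the gap between
  -- the supremum and the soft value of `r⋆`.
  have h1 : ∫ p, Real.sigmoid (rewardDiff rstar p) ∂(pairLaw ρ πstar πsam)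
      ≤ lightBonus ρ β πref πsam πs
        + (∫ x, rewardSup rstar x ∂ρ - ∫ x, softValue β πref rstar x ∂ρ) := by
    rw [e1, ← e3, ← e4, ← integral_sub i3 i4, ← integral_add i1 i34]
    refine integral_mono (j πstar hs) (i1.add i34) fun p => ?_
    refine (sigmoid_le_add_sub (b := rewardSup rstar p.1 - rstar p.1 p.2.2)
      (c := softValue β πref rstar p.1 - rstar p.1 p.2.2) ?_ ?_).trans_eq ?_
    · unfold rewardDiff; linarith [hs.le_rewardSup p.1 p.2.1]
    · linarith [hs.softValue_le_rewardSup hβ πref p.1]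
    · simp
  -- Conversely the bonus of the played policy is at most its win rate under its own reward `r`, up
  -- to its suboptimality for `r`; `h3` bounds that suboptimality by a regularization gap.
  have h2 : lightBonus ρ β πref πsam π
      ≤ ∫ p, Real.sigmoid (rewardDiff r p) ∂(pairLaw ρ π πsam)
        + (∫ x, rewardSup r x ∂ρ - expReward ρ r π) := by
    rw [e2, ← e5, ← e6, ← integral_sub i5 i6, ← integral_add (j π hr) i56]
    refine integral_mono i2 ((j π hr).add i56) fun p => ?_
    refine (sigmoid_le_add_sub (b := rewardSup r p.1 - r p.1 p.2.2)
      (c := rewardDiff r p) ?_ ?_).trans_eq ?_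
    · linarith [hr.softValue_le_rewardSup hβ πref p.1]
    · unfold rewardDiff; linarith [hr.le_rewardSup p.1 p.2.1]
    · simp [rewardDiff]
  have h3 : ∫ x, softValue β πref r x ∂ρ ≤ expReward ρ r π := by
    refine integral_mono_ae (hr.integrable_softValue hβ πref) (hr.integrable_expected π) ?_
    filter_upwards [hπ] with x hx
    rw [hx]
    exact (mul_klDiv_gibbs hr hβ πref x).1
  have h4 : ∫ p, Real.sigmoid (rewardDiff r p) ∂(pairLaw ρ π πsam)
      - ∫ p, Real.sigmoid (rewardDiff rstar p) ∂(pairLaw ρ π πsam)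
      ≤ ∫ p, |Real.sigmoid (rewardDiff r p) - Real.sigmoid (rewardDiff rstar p)|
          ∂(pairLaw ρ π πsam) := by
    rw [← integral_sub (j π hr) (j π hs)]
    exact integral_mono ((j π hr).sub (j π hs)) ((j π hr).sub (j π hs)).abs
      fun p => le_abs_self _
  linarith

end RoundRegret

/-! ### Optimism of the chosen policy and summation of the prediction errors. -/

section Regret

open Matrix

variable {X Y : Type*} [MeasurableSpace X] [MeasurableSpace Y]

lemma lightBonus_nonneg (ρ : Measure X) (β : ℝ) (πref πsam π : Policy X Y) :
    0 ≤ lightBonus ρ β πref πsam π :=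
  integral_nonneg fun _ => integral_nonneg fun _ => Real.sigmoid_nonneg _

/-- Optimism: a maximizer of the objective has nearly the bonus of any member `πs` of the class
whose loss is `γ`-minimal, and its loss exceeds that of `πs` by at most `γ`. -/
lemma bonus_sub_le_of_isMax {ρ : Measure X} {β α γ : ℝ} (hα : 0 < α) (hγ : 0 ≤ γ)
    {πref πsam π πs : Policy X Y} {𝒞 : Set (Policy X Y)} {z : ℕ → Sample X Y} {n : ℕ}
    (hs : πs ∈ 𝒞)
    (hmax : objective ρ β α γ πref πsam 𝒞 πs z n ≤ objective ρ β α γ πref πsam 𝒞 π z n)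
    (hγs : ∀ π' ∈ 𝒞, dpoLoss β πref πs z n - dpoLoss β πref π' z n ≤ γ)
    (hπ : π ∈ 𝒞) :
    lightBonus ρ β πref πsam πs - lightBonus ρ β πref πsam π ≤ γ / α ∧
    dpoLoss β πref π z n - dpoLoss β πref πs z n ≤ γ := by
  have h0 := lightBonus_nonneg ρ β πref πsam πs
  have h1 := lightBonus_nonneg ρ β πref πsam π
  unfold objective at hmax
  have ht : truncation β γ πref 𝒞 πs z n = 1 := if_pos hγs
  rw [ht, mul_one] at hmax
  have h2 := hγs π hπ
  have hαs : 0 ≤ α * lightBonus ρ β πref πsam πs := by positivity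
  have hαp : 0 ≤ α * lightBonus ρ β πref πsam π := by positivity
  rw [le_div_iff₀ hα]
  -- Outside the truncation the maximizer earns no bonus, so its loss lies below that of `πs` by at
  -- least `α` times the bonus of `πs`; that margin is at most `γ`.
  by_cases hc : ∀ π' ∈ 𝒞, dpoLoss β πref π z n - dpoLoss β πref π' z n ≤ γ
  · have ht' : truncation β γ πref 𝒞 π z n = 1 := if_pos hc
    rw [ht', mul_one] at hmax
    exact ⟨by linarith, hc πs hs⟩
  · have ht' : truncation β γ πref 𝒞 π z n = 0 := if_neg hc
    rw [ht', mul_zero] at hmax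
    exact ⟨by linarith, by linarith⟩

variable [Countable Y] [MeasurableSingletonClass Y]

/-- The feature difference of two responses. -/
def featureDiff {d : ℕ} (φ : X → Y → EuclideanSpace ℝ (Fin d)) (p : X × Y × Y) : Fin d → ℝ :=
  (φ p.1 p.2.1 - φ p.1 p.2.2).ofLp

omit [MeasurableSpace X] [MeasurableSpace Y] [Countable Y] [MeasurableSingletonClass Y] in
lemma rewardDiff_eq_dotProduct {d : ℕ} {φ : X → Y → EuclideanSpace ℝ (Fin d)} {r : X → Y → ℝ}
    {θ : EuclideanSpace ℝ (Fin d)} (h : ∀ x y, r x y = inner ℝ (φ x y) θ) (p : X × Y × Y) :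
    rewardDiff r p = featureDiff φ p ⬝ᵥ θ.ofLp := by
  unfold rewardDiff featureDiff
  rw [h, h, ← inner_sub_left, EuclideanSpace.inner_eq_star_dotProduct, dotProduct_comm]
  simp

lemma dotProduct_self_eq_norm_sq {d : ℕ} (v : EuclideanSpace ℝ (Fin d)) :
    v.ofLp ⬝ᵥ v.ofLp = ‖v‖ ^ 2 := by
  rw [← real_inner_self_eq_norm_sq, EuclideanSpace.inner_eq_star_dotProduct]
  simp

lemma measurable_featureDiff {d : ℕ} {φ : X → Y → EuclideanSpace ℝ (Fin d)}
    (hφ : ∀ y, Measurable fun x => φ x y) : Measurable (featureDiff φ) := by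
  have h : Measurable fun p : X × Y => φ p.1 p.2 := measurable_from_prod_countable_left hφ
  have h1 : Measurable fun p : X × Y × Y => φ p.1 p.2.1 - φ p.1 p.2.2 :=
    (h.comp (measurable_fst.prodMk measurable_snd.fst)).sub
      (h.comp (measurable_fst.prodMk measurable_snd.snd))
  exact (PiLp.continuous_ofLp 2 _).measurable.comp h1

/-- The prediction errors on the data laws, when the information gathered about each reward
before it is used is bounded. -/
lemma sum_integral_abs_sigmoid_sub_le {d : ℕ} (hd : 0 < d) {Rmax : ℝ} (hRmax : 1 ≤ Rmax)
    {φ : X → Y → EuclideanSpace ℝ (Fin d)} (hφ : ∀ y, Measurable fun x => φ x y)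
    (hφ1 : ∀ x y y', ‖φ x y - φ x y'‖ ≤ 1) {ρ : Measure X} [IsProbabilityMeasure ρ]
    {πsam : Policy X Y} (p : ℕ → Policy X Y) {rstar : X → Y → ℝ} (r : ℕ → X → Y → ℝ)
    (hs : ∃ θ : EuclideanSpace ℝ (Fin d), ‖θ‖ ≤ Rmax ∧ ∀ x y, rstar x y = inner ℝ (φ x y) θ)
    (hr : ∀ t, ∃ θ : EuclideanSpace ℝ (Fin d), ‖θ‖ ≤ Rmax ∧
      ∀ x y, r t x y = inner ℝ (φ x y) θ)
    {T : ℕ} (hT : 0 < T) {A : ℝ} (hA : 0 ≤ A)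
    (hinfo : ∀ t < T, ∑ s ∈ Finset.range t, hellingerGap ρ (r t) rstar (p s) πsam ≤ A) :
    ∑ t ∈ Finset.range T, ∫ q, |Real.sigmoid (rewardDiff (r t) q)
        - Real.sigmoid (rewardDiff rstar q)| ∂(pairLaw ρ (p t) πsam)
      ≤ 2 * √((4 + 128 * A) * (T * (2 * (d * Real.log (1 + T * Rmax ^ 2 / d)))))
        + 4 * Real.exp Rmax * (4 + 128 * A) * (2 * (d * Real.log (1 + T * Rmax ^ 2 / d))) := by
  obtain ⟨θs, hθs, hrs⟩ := hs
  choose θ hθ hrθ using hr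
  have hdR : (0 : ℝ) < d := by exact_mod_cast hd
  have hTR : (0 : ℝ) < T := by exact_mod_cast hT
  have hR0 : 0 < Rmax := by linarith
  have := Fin.pos_iff_nonempty.1 hd
  set Q := 2 * (d * Real.log (1 + T * Rmax ^ 2 / d)) with hQ
  have hQ0 : 0 < Q := by
    have : 0 < Real.log (1 + T * Rmax ^ 2 / d) := Real.log_pos (by
      have : 0 < T * Rmax ^ 2 / d := by positivity
      linarith)
    positivity
  set B := 4 + 128 * A with hB
  have hψ1 : ∀ q, featureDiff φ q ⬝ᵥ featureDiff φ q ≤ 1 := fun q => by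
    unfold featureDiff
    rw [dotProduct_self_eq_norm_sq]
    exact pow_le_one₀ (norm_nonneg _) (hφ1 _ _ _)
  have hds : Measurable (rewardDiff rstar) := by
    have : rewardDiff rstar = fun q => featureDiff φ q ⬝ᵥ θs.ofLp := by
      ext q; exact rewardDiff_eq_dotProduct hrs q
    rw [this]
    have hc : Continuous fun u : Fin d → ℝ => u ⬝ᵥ θs.ofLp := by fun_prop
    exact hc.measurable.comp (measurable_featureDiff hφ)
  have hdr : ∀ t, Measurable (rewardDiff (r t)) := by
    intro t
    have : rewardDiff (r t) = fun q => featureDiff φ q ⬝ᵥ (θ t).ofLp := by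
      ext q; exact rewardDiff_eq_dotProduct (hrθ t) q
    rw [this]
    have hc : Continuous fun u : Fin d → ℝ => u ⬝ᵥ (θ t).ofLp := by fun_prop
    exact hc.measurable.comp (measurable_featureDiff hφ)
  have hw : ∀ t q, featureDiff φ q ⬝ᵥ (θ t - θs).ofLp = rewardDiff (r t) q - rewardDiff rstar q := by
    intro t q
    rw [rewardDiff_eq_dotProduct hrs, rewardDiff_eq_dotProduct (hrθ t), ← dotProduct_sub]
    rfl
  have habs : ∀ q, |rewardDiff rstar q| ≤ Rmax := by
    intro q
    unfold rewardDiff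
    rw [hrs, hrs, ← inner_sub_left]
    refine (abs_real_inner_le_norm _ _).trans ?_
    calc _ ≤ 1 * Rmax := mul_le_mul (hφ1 _ _ _) hθs (norm_nonneg _) zero_le_one
      _ = Rmax := one_mul _
  have hdsm : Measurable fun q => dsigmoid (rewardDiff rstar q) := by
    unfold dsigmoid
    have := continuous_sigmoid.measurable.comp hds
    exact this.mul (measurable_const.sub this)
  have hη : 0 < √(Q / T) := Real.sqrt_pos.2 (by positivity)
  -- The regularization `c = 1 / Rmax²` makes `c ‖θ - θ⋆‖²` at most `4`, the first summand of `B`.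
  -- The choice `η = √(Q / T)` balances the two terms containing `η`.
  have key := sum_integral_le_of_decoupling (Z := X × Y × Y) (n := Fin d)
    (c := 1 / Rmax ^ 2) (g := fun q => dsigmoid (rewardDiff rstar q)) (ψ := featureDiff φ)
    (by positivity) (B := B) (K := 2) (m := Real.exp (-Rmax) / 4) (η := √(Q / T))
    (by linarith) (by norm_num) (by positivity) hη hdsm
    (fun q => exp_neg_le_dsigmoid (habs q))
    (fun q => (dsigmoid_le _).trans (by norm_num)) (measurable_featureDiff hφ) hψ1
    (fun t => pairLaw ρ (p t) πsam) T (fun t => (θ t - θs).ofLp)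
    (by
      intro t ht
      rw [dotProduct_self_eq_norm_sq]
      have h1 : 1 / Rmax ^ 2 * ‖θ t - θs‖ ^ 2 ≤ 4 := by
        rw [div_mul_eq_mul_div, div_le_iff₀ (by positivity)]
        have h2 : ‖θ t - θs‖ ≤ 2 * Rmax := (norm_sub_le _ _).trans (by linarith [hθ t])
        nlinarith [norm_nonneg (θ t - θs)]
      have h2 : ∑ s ∈ Finset.range t, ∫ q, dsigmoid (rewardDiff rstar q)
          * min 1 ((featureDiff φ q ⬝ᵥ (θ t - θs).ofLp) ^ 2) ∂(pairLaw ρ (p s) πsam)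
          ≤ ∑ s ∈ Finset.range t, 128 * hellingerGap ρ (r t) rstar (p s) πsam := by
        refine Finset.sum_le_sum fun s _ => ?_
        unfold hellingerGap
        rw [← integral_const_mul]
        refine integral_mono_of_nonneg (Filter.Eventually.of_forall fun q =>
          mul_nonneg (dsigmoid_pos _).le (le_min zero_le_one (sq_nonneg _))) ?_
          (Filter.Eventually.of_forall fun q => ?_)
        · refine Integrable.const_mul (integrable_of_bounded (measurable_const.sub
            (continuous_affinity.measurable.comp ((hdr t).prodMk hds))) 1 fun q => ?_) _
          have a0 := affinity_nonneg (rewardDiff (r t) q) (rewardDiff rstar q)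
          have a1 := affinity_le_one (rewardDiff (r t) q) (rewardDiff rstar q)
          change |1 - affinity (rewardDiff (r t) q) (rewardDiff rstar q)| ≤ 1
          rw [abs_of_nonneg (by linarith)]
          linarith
        · dsimp only
          rw [hw]
          exact dsigmoid_mul_min_le_one_sub_affinity _ _
      rw [← Finset.mul_sum] at h2
      have h3 := hinfo t ht
      linarith)
    (fun t q => |Real.sigmoid (rewardDiff (r t) q) - Real.sigmoid (rewardDiff rstar q)|)
    (fun t => (((continuous_sigmoid.measurable.comp (hdr t)).sub
      (continuous_sigmoid.measurable.comp hds)).norm))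
    (fun t q => abs_nonneg _)
    (fun t q => abs_le.2 ⟨by
      linarith [Real.sigmoid_nonneg (rewardDiff (r t) q), Real.sigmoid_le_one (rewardDiff rstar q)],
      by linarith [Real.sigmoid_le_one (rewardDiff (r t) q),
        Real.sigmoid_nonneg (rewardDiff rstar q)]⟩)
    (fun t q h => by
      rw [hw] at h ⊢
      exact (abs_sigmoid_sub_le_dsigmoid h).trans_eq (by ring))
  refine key.trans_eq ?_
  rw [Fintype.card_fin]
  have e1 : (T : ℝ) / (d * (1 / Rmax ^ 2)) = T * Rmax ^ 2 / d := by field_simp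
  rw [e1, ← hQ]
  have hB0 : 0 ≤ B := by linarith
  have e2 : T * √(Q / T) = √(T * Q) := by
    rw [eq_comm, Real.sqrt_eq_iff_mul_self_eq (by positivity) (by positivity)]
    have := Real.mul_self_sqrt (show 0 ≤ Q / T by positivity)
    refine Eq.symm ?_
    calc _ = T * T * (√(Q / T) * √(Q / T)) := by ring
      _ = T * Q := by rw [this]; field_simp
  have e3 : Q / √(Q / T) = √(T * Q) := by
    rw [← e2, div_eq_iff hη.ne', mul_assoc, Real.mul_self_sqrt (by positivity)]
    field_simp
  rw [Real.sqrt_mul hB0, Real.exp_neg]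
  calc _ = √B * (T * √(Q / T)) + √B * (Q / √(Q / T)) + B / ((Real.exp Rmax)⁻¹ / 4) * Q := by
        ring
    _ = _ := by
        rw [e2, e3, div_div_eq_mul_div, div_inv_eq_mul]
        ring

end Regret

/-! ### Numerical simplification of the rates. -/

section Rates

/-- The rates of the decoupling argument in terms of the two leading terms of the regret. -/
lemma rate_le {d T Rmax L S E : ℝ} (hd : 1 ≤ d) (hT : 2 * d ≤ T) (hR : 1 ≤ Rmax)
    (hL : Real.log 2 ≤ L) (hS : S = √(d * Rmax * T * Real.log (T * Rmax / d) * L))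
    (hE : E = d * Real.exp Rmax * Real.log (T * Rmax / d) * L) :
    1 + 2 * √((4 + 128 * (2 * L)) * (T * (2 * (d * Real.log (1 + T * Rmax ^ 2 / d)))))
      + 4 * Real.exp Rmax * (4 + 128 * (2 * L)) * (2 * (d * Real.log (1 + T * Rmax ^ 2 / d)))
      ≤ 80 * S + 6300 * E := by
  have hd0 : 0 < d := by linarith
  have hT0 : 0 < T := by linarith
  have hR0 : 0 < Rmax := by linarith
  have hlog2 := Real.log_two_gt_d9
  set u := T * Rmax / d with hu
  have hu2 : 2 ≤ u := by
    rw [hu, le_div_iff₀ hd0]; nlinarith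
  set l := Real.log u with hl
  have hl2 : Real.log 2 ≤ l := Real.log_le_log (by norm_num) hu2
  -- From `d ≤ T` the fraction is at most `u²`, and `1 + u² ≤ u³` because `u ≥ 2`.
  have hq : Real.log (1 + T * Rmax ^ 2 / d) ≤ 3 * l := by
    have h1 : 1 + T * Rmax ^ 2 / d ≤ u ^ 3 := by
      have h2 : T * Rmax ^ 2 / d ≤ u ^ 2 := by
        rw [hu, div_pow, div_le_div_iff₀ hd0 (by positivity)]
        have : d ≤ T := by linarith
        calc T * Rmax ^ 2 * d ^ 2 = T * Rmax ^ 2 * d * d := by ring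
          _ ≤ T * Rmax ^ 2 * d * T := by gcongr
          _ = _ := by ring
      nlinarith [sq_nonneg u]
    have h3 := Real.log_le_log (by positivity) h1
    rwa [Real.log_pow] at h3
  have hq0 : 0 ≤ Real.log (1 + T * Rmax ^ 2 / d) := Real.log_nonneg (by
    have : 0 ≤ T * Rmax ^ 2 / d := by positivity
    linarith)
  have hl0 : 0 < l := by linarith
  have hL0 : 0 < L := by linarith
  -- `4 ≤ 6 L`, since `L ≥ log 2 > 2/3`. Then `262 · 6 = 1572 ≤ 40²` and `4 · 262 · 6 = 6288` give
  -- the constants below.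
  have hB : 4 + 128 * (2 * L) ≤ 262 * L := by linarith
  have h1 : √((4 + 128 * (2 * L)) * (T * (2 * (d * Real.log (1 + T * Rmax ^ 2 / d)))))
      ≤ 40 * S := by
    rw [hS]
    refine Real.sqrt_le_iff.2 ⟨by positivity, ?_⟩
    rw [mul_pow, Real.sq_sqrt (by positivity)]
    calc _ ≤ (262 * L) * (T * (2 * (d * (3 * l)))) := by gcongr
      _ = 1572 * (d * 1 * T * l * L) := by ring
      _ ≤ 40 ^ 2 * (d * Rmax * T * l * L) := by
          have : d * 1 * T * l * L ≤ d * Rmax * T * l * L := by gcongr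
          have h0 : 0 ≤ d * Rmax * T * l * L := by positivity
          linarith
  have h2 : 4 * Real.exp Rmax * (4 + 128 * (2 * L))
      * (2 * (d * Real.log (1 + T * Rmax ^ 2 / d))) ≤ 6288 * E := by
    rw [hE]
    calc _ ≤ 4 * Real.exp Rmax * (262 * L) * (2 * (d * (3 * l))) := by gcongr
      _ = _ := by ring
  -- Absorbs the regret `1` of the first round; `(log 2)² > 1/3` is the numerical input.
  have h3 : 1 ≤ 3 * E := by
    have h4 : 1 ≤ Real.exp Rmax := Real.one_le_exp (by linarith)
    have h5 : 1 * 1 ≤ d * Real.exp Rmax := by gcongr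
    have h6 : Real.log 2 * Real.log 2 ≤ l * L := by gcongr
    have h7 : (1 : ℝ) / 3 ≤ l * L := by nlinarith
    have h8 : 1 * (1 / 3) ≤ d * Real.exp Rmax * (l * L) := by gcongr; linarith
    rw [hE]; linarith
  have h9 : 0 ≤ E := by linarith
  linarith

lemma mul_div_bonus_weight_le {d T Rmax L α : ℝ} (hd : 1 ≤ d) (hT : 2 * d ≤ T) (hR : 1 ≤ Rmax)
    (hL : Real.log 2 ≤ L) (hα : α = √(T * L / (d * Rmax * Real.log (T / d)))) :
    0 < α ∧ T * (2 * L / α) ≤ 2 * √(d * Rmax * T * Real.log (T * Rmax / d) * L) := by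
  have hd0 : 0 < d := by linarith
  have hT0 : 0 < T := by linarith
  have hlog2 := Real.log_two_gt_d9
  have hL0 : 0 < L := by linarith
  have hTd : 2 ≤ T / d := by rw [le_div_iff₀ hd0]; linarith
  have hl0 : 0 < Real.log (T / d) := Real.log_pos (by linarith)
  have hα0 : 0 < α := by rw [hα]; exact Real.sqrt_pos.2 (by positivity)
  refine ⟨hα0, ?_⟩
  have h1 : α * √(d * Rmax * T * Real.log (T / d) * L) = T * L := by
    rw [hα, ← Real.sqrt_mul (by positivity)]
    have : T * L / (d * Rmax * Real.log (T / d)) * (d * Rmax * T * Real.log (T / d) * L)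
        = (T * L) ^ 2 := by field_simp
    rw [this, Real.sqrt_sq (by positivity)]
  have h2 : T * (2 * L / α) = 2 * √(d * Rmax * T * Real.log (T / d) * L) := by
    have : T * (2 * L / α) = 2 * (T * L) / α := by ring
    rw [this, ← h1]; field_simp
  rw [h2]
  have h3 : Real.log (T / d) ≤ Real.log (T * Rmax / d) := by
    refine Real.log_le_log (by positivity) ?_
    gcongr
    nlinarith
  gcongr

end Rates

/-! ### The regret bound on the good event. -/

section RegretBound

variable {X Y : Type*} [MeasurableSpace X] [MeasurableSpace Y] [Countable Y]
  [MeasurableSingletonClass Y]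

/-- The regret bound on a realization whose likelihoods concentrate. -/
theorem prefRegret_le {d : ℕ} (hd : 0 < d) {Rmax : ℝ} (hRmax : 1 ≤ Rmax)
    {φ : X → Y → EuclideanSpace ℝ (Fin d)} (hφ : ∀ y, Measurable fun x => φ x y)
    (hφ1 : ∀ x y y', ‖φ x y - φ x y'‖ ≤ 1) {ρ : Measure X} [IsProbabilityMeasure ρ]
    {πref πsam : Policy X Y} (hsam : ∀ᵐ x ∂ρ, πsam.at x ≪ πref.at x)
    {R : Finset (X → Y → ℝ)}
    (hlin : ∀ r ∈ R, ∃ θ : EuclideanSpace ℝ (Fin d), ‖θ‖ ≤ Rmax ∧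
      ∀ x y, r x y = inner ℝ (φ x y) θ)
    {rstar : X → Y → ℝ} (hrstar : rstar ∈ R) {β : ℝ} (hβ : 0 < β)
    (hbdd : ∀ r ∈ R, IsBoundedReward ρ r Rmax) {πreg : (X → Y → ℝ) → Policy X Y}
    (hreg : ∀ r (hr : r ∈ R), ∀ᵐ x ∂ρ, (πreg r).at x = (gibbs (hbdd r hr) hβ πref).at x)
    {G : ℝ} (hG : ∀ r ∈ R, ∫ x, rewardSup r x ∂ρ - ∫ x, softValue β πref r x ∂ρ ≤ G)
    {T : ℕ} (hT : 0 < T) {α L : ℝ} (hα : 0 < α) (hL : 0 ≤ L) {p : ℕ → Policy X Y}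
    {z : ℕ → Sample X Y}
    (hmem : ∀ t, t + 1 < T → p (t + 1) ∈ πreg '' (R : Set (X → Y → ℝ)))
    (hmax : ∀ t, t + 1 < T → ∀ π' ∈ πreg '' (R : Set (X → Y → ℝ)),
      objective ρ β α (2 * L) πref πsam (πreg '' (R : Set (X → Y → ℝ))) π' z (t + 1)
        ≤ objective ρ β α (2 * L) πref πsam (πreg '' (R : Set (X → Y → ℝ))) (p (t + 1)) z (t + 1))
    (hloss : ∀ r ∈ R, ∀ n ≤ T, dpoLoss β πref (πreg r) z n
      = -∑ s ∈ Finset.range n, logLik r (z s))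
    (hconc : ∀ r ∈ R, ∀ t ≤ T, ∑ s ∈ Finset.range t, ((logLik r (z s) - logLik rstar (z s)) / 2
        + hellingerGap ρ r rstar (p s) πsam) ≤ L) (πstar : Policy X Y) :
    prefRegret ρ rstar πstar πsam p T
      ≤ 1 + T * (2 * L / α) + T * (2 * G)
        + 2 * √((4 + 128 * (2 * L)) * (T * (2 * (d * Real.log (1 + T * Rmax ^ 2 / d)))))
        + 4 * Real.exp Rmax * (4 + 128 * (2 * L))
          * (2 * (d * Real.log (1 + T * Rmax ^ 2 / d))) := by
  choose! ρr hρr hpr using hmem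
  -- `r t` is a reward whose regularized policy is played in round `t`. The default `rstar` covers
  -- round `0`, where there is no past information to bound, and the indices beyond the horizon.
  set r : ℕ → X → Y → ℝ := fun t => if 0 < t ∧ t < T then ρr (t - 1) else rstar with hr
  have hrR : ∀ t, r t ∈ R := by
    intro t
    simp only [hr]
    split_ifs with h
    · exact hρr (t - 1) (by omega)
    · exact hrstar
  have hpt : ∀ t, 0 < t → t < T → πreg (r t) = p t := by
    intro t h0 h1
    simp only [hr, if_pos (And.intro h0 h1)]
    rw [hpr (t - 1) (by omega), Nat.sub_add_cancel h0]
  -- Twice the concentration inequality, written with losses. Dropping the Hellinger term shows that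
  -- `π(r⋆)` is `2L`-minimal; keeping it bounds the information about `r`.
  have hloss' : ∀ r ∈ R, ∀ t ≤ T,
      dpoLoss β πref (πreg rstar) z t - dpoLoss β πref (πreg r) z t
        + 2 * ∑ s ∈ Finset.range t, hellingerGap ρ r rstar (p s) πsam ≤ 2 * L := by
    intro r hr t ht
    have h1 := hconc r hr t ht
    rw [Finset.sum_add_distrib, ← Finset.sum_div, Finset.sum_sub_distrib] at h1
    rw [hloss r hr t ht, hloss rstar hrstar t ht]
    linarith
  have hnn : ∀ r t, 0 ≤ ∑ s ∈ Finset.range t, hellingerGap ρ r rstar (p s) πsam := fun r t =>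
    Finset.sum_nonneg fun s _ => hellingerGap_nonneg _ _ _ _ _
  have hopt : ∀ t, 0 < t → t < T →
      lightBonus ρ β πref πsam (πreg rstar) - lightBonus ρ β πref πsam (p t) ≤ 2 * L / α ∧
      dpoLoss β πref (p t) z t - dpoLoss β πref (πreg rstar) z t ≤ 2 * L := by
    intro t h0 h1
    obtain ⟨t, rfl⟩ : ∃ k, t = k + 1 := ⟨t - 1, by omega⟩
    refine bonus_sub_le_of_isMax (ρ := ρ) (πsam := πsam) (π := p (t + 1))
      (𝒞 := πreg '' (R : Set (X → Y → ℝ))) hα (by linarith) ⟨rstar, hrstar, rfl⟩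
      (hmax t h1 _ ⟨rstar, hrstar, rfl⟩) ?_ ⟨r (t + 1), hrR _, hpt _ h0 h1⟩
    rintro _ ⟨r', hr', rfl⟩
    linarith [hloss' r' hr' (t + 1) h1.le, hnn r' (t + 1)]
  -- The played policy loses at most `2L` more than `π(r⋆)`, and concentration costs another `2L`;
  -- halving the total leaves `2L`.
  have hinfo : ∀ t < T, ∑ s ∈ Finset.range t, hellingerGap ρ (r t) rstar (p s) πsam ≤ 2 * L := by
    intro t ht
    rcases Nat.eq_zero_or_pos t with rfl | h0
    · simpa using hL
    · have h1 := hloss' (r t) (hrR t) t ht.le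
      have h2 := (hopt t h0 ht).2
      rw [hpt t h0 ht] at h1
      linarith
  have hsum := sum_integral_abs_sigmoid_sub_le hd hRmax hφ hφ1 (ρ := ρ) (πsam := πsam) p r
    (hlin _ hrstar) (fun t => hlin _ (hrR t)) hT (by linarith : 0 ≤ 2 * L) hinfo
  have hs := hbdd _ hrstar
  have hG0 : 0 ≤ G := by
    have := ρ.nonempty_response πref
    refine le_trans (sub_nonneg.2 ?_) (hG _ hrstar)
    exact integral_mono (hs.integrable_softValue hβ πref) hs.integrable_rewardSup
      (hs.softValue_le_rewardSup hβ πref)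
  have hround : ∀ t ∈ Finset.range T, ∫ x, ∫ ystar, ∫ y, ∫ y',
      (pref rstar x ystar y' - pref rstar x y y')
        ∂(πsam.at x) ∂((p t).at x) ∂(πstar.at x) ∂ρ
      ≤ (if t = 0 then 1 else 0) + (2 * L / α + 2 * G
        + ∫ q, |Real.sigmoid (rewardDiff (r t) q) - Real.sigmoid (rewardDiff rstar q)|
          ∂(pairLaw ρ (p t) πsam)) := by
    intro t ht
    have ht := Finset.mem_range.1 ht
    have hint : 0 ≤ ∫ q, |Real.sigmoid (rewardDiff (r t) q) - Real.sigmoid (rewardDiff rstar q)|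
          ∂(pairLaw ρ (p t) πsam) := integral_nonneg fun _ => abs_nonneg _
    rcases Nat.eq_zero_or_pos t with rfl | h0
    · have h1 := roundRegret_le_one (ρ := ρ) (πsam := πsam) (π := p 0) (πstar := πstar)
        hs.measurable
      have h2 : 0 ≤ 2 * L / α := by positivity
      rw [if_pos rfl]
      linarith
    · have hπ : ∀ᵐ x ∂ρ, (p t).at x = (gibbs (hbdd _ (hrR t)) hβ πref).at x := by
        rw [← hpt t h0 ht]; exact hreg _ (hrR t)
      have h1 := roundRegret_le (πstar := πstar) (hbdd _ (hrR t)) hs hβ hsam hπ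
        (hreg _ hrstar)
      rw [if_neg h0.ne']
      linarith [hG _ hrstar, hG _ (hrR t), (hopt t h0 ht).1]
  unfold prefRegret
  refine (Finset.sum_le_sum hround).trans ?_
  rw [Finset.sum_add_distrib, Finset.sum_add_distrib, Finset.sum_const, Finset.card_range,
    nsmul_eq_mul, Finset.sum_ite_eq' (Finset.range T) 0, if_pos (Finset.mem_range.2 hT)]
  linarith

omit [MeasurableSpace Y] [Countable Y] [MeasurableSingletonClass Y] in
lemma isBoundedReward_of_linear {d : ℕ} {Rmax : ℝ}
    {φ : X → Y → EuclideanSpace ℝ (Fin d)} (hφ : ∀ y, Measurable fun x => φ x y)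
    {ρ : Measure X} (hφi : ∀ y, Integrable (fun x => φ x y) ρ)
    (hφ1 : ∀ x y y', ‖φ x y - φ x y'‖ ≤ 1) {r : X → Y → ℝ}
    (hr : ∃ θ : EuclideanSpace ℝ (Fin d), ‖θ‖ ≤ Rmax ∧ ∀ x y, r x y = inner ℝ (φ x y) θ) :
    IsBoundedReward ρ r Rmax := by
  obtain ⟨θ, hθ, hrθ⟩ := hr
  have hfun : ∀ y, (fun x => r x y) = fun x => inner ℝ (φ x y) θ := fun y => by
    ext x; exact hrθ x y
  refine ⟨fun y => ?_, fun y => ?_, fun x y y' => ?_⟩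
  · rw [hfun]; exact (hφ y).inner measurable_const
  · rw [hfun]; exact (hφi y).inner_const θ
  · rw [hrθ, hrθ, ← inner_sub_left]
    refine (abs_real_inner_le_norm _ _).trans ?_
    calc _ ≤ 1 * Rmax := mul_le_mul (hφ1 _ _ _) hθ (norm_nonneg _) zero_le_one
      _ = Rmax := one_mul _

end RegretBound

end POPO

theorem theorem3 :
    ∃ C : ℝ, 0 < C ∧
      ∀ (X : Type*) (Y : Type*) (Ω : Type*) [MeasurableSpace X] [MeasurableSpace Y]
        [Countable Y] [MeasurableSingletonClass Y] [mΩ : MeasurableSpace Ω]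
        -- prompt distribution, reference policy, sampler
        (ρ : Measure X) [IsProbabilityMeasure ρ] (πref πsam : POPO.Policy X Y)
        (_ : ∀ᵐ x ∂ρ, πsam.at x ≪ πref.at x)
        -- linear reward class containing the true reward
        (d : ℕ) (_ : 0 < d) (Rmax : ℝ) (_ : 1 ≤ Rmax)
        (φ : X → Y → EuclideanSpace ℝ (Fin d))
        (_ : ∀ y, Measurable (fun x => φ x y)) (_ : ∀ y, Integrable (fun x => φ x y) ρ)
        (_ : ∀ x y y', ‖φ x y - φ x y'‖ ≤ 1)
        (R : Finset (X → Y → ℝ))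
        (_ : ∀ r ∈ R, ∃ θ : EuclideanSpace ℝ (Fin d), ‖θ‖ ≤ Rmax ∧
          ∀ x y, r x y = inner ℝ (φ x y) θ)
        (rstar : X → Y → ℝ) (_ : rstar ∈ R)
        -- the KL-regularized optimal policies `π(r)` and the optimal policies `π⋆_r`
        (β : ℝ) (_ : 0 < β)
        (πreg : (X → Y → ℝ) → POPO.Policy X Y)
        (_ : ∀ r ∈ R, POPO.IsRegularizedOptimal ρ β πref r (πreg r))
        (πopt : (X → Y → ℝ) → POPO.Policy X Y)
        (_ : ∀ r ∈ R, POPO.IsRewardOptimal ρ r (πopt r))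
        -- horizon, confidence and the parameters of the algorithm
        (T : ℕ) (_ : 2 * d ≤ T) (δ : ℝ) (_ : 0 < δ) (_ : δ < 1)
        (α γ : ℝ)
        (_ : α = Real.sqrt (T * Real.log (R.card / δ) / (d * Rmax * Real.log (T / d))))
        (_ : γ = 2 * Real.log (R.card / δ))
        -- a run of the algorithm
        (P : Measure Ω) [IsProbabilityMeasure P] (ℱ : Filtration ℕ mΩ)
        (π : ℕ → Ω → POPO.Policy X Y) (z : ℕ → Ω → POPO.Sample X Y)
        (_ : POPO.IsRun P ℱ T ρ β α γ rstar πref πsam (πreg '' (R : Set (X → Y → ℝ))) π z),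
        ENNReal.ofReal (1 - 2 * δ) ≤
          P {ω | ENNReal.ofReal
              (POPO.prefRegret ρ rstar (πopt rstar) πsam (fun t => π t ω) T) ≤
            ENNReal.ofReal C *
              (ENNReal.ofReal
                  (Real.sqrt (d * Rmax * T * Real.log (T * Rmax / d) * Real.log (R.card / δ)))
                + ENNReal.ofReal
                  (d * Real.exp Rmax * Real.log (T * Rmax / d) * Real.log (R.card / δ))
                + ENNReal.ofReal (β * T) *
                  R.sup (fun r => POPO.expKL ρ (πopt r) πref))} := by
  -- The coefficients obtained are `80 + 2` for the square root, `6300` for the exponential term and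
  -- `2` for the divergence; the largest serves for all.
  refine ⟨6300, by norm_num, ?_⟩
  intro X Y Ω _ _ _ _ mΩ ρ _ πref πsam hsam d hd Rmax hRmax φ hφ hφi hφ1 R hlin rstar hrstar β hβ
    πreg hreg πopt hopt T hT δ hδ hδ1 α γ hα hγ P _ ℱ π z hrun
  -- For `δ ≥ 1/2` nothing is claimed. Otherwise `|R| / δ ≥ 2`, which gives the lower bound `log 2`
  -- on `L` used in the rates.
  rcases le_or_gt (1 / 2) δ with hδ2 | hδ2
  · rw [ENNReal.ofReal_of_nonpos (by linarith)]
    exact zero_le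
  have hcard : (1 : ℝ) ≤ R.card := by exact_mod_cast Finset.card_pos.2 ⟨_, hrstar⟩
  have hL : Real.log 2 ≤ Real.log (R.card / δ) := by
    refine Real.log_le_log (by norm_num) ?_
    rw [le_div_iff₀ hδ]; linarith
  have hL0 : 0 < Real.log (R.card / δ) := lt_of_lt_of_le (Real.log_pos (by norm_num)) hL
  set L := Real.log (R.card / δ) with hLdef
  have hdR : (1 : ℝ) ≤ d := by exact_mod_cast hd
  have hTR : 2 * (d : ℝ) ≤ T := by exact_mod_cast hT
  have hT0 : 0 < T := by omega
  obtain ⟨hα0, hαT⟩ := POPO.mul_div_bonus_weight_le hdR hTR hRmax hL hα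
  have hbdd : ∀ r ∈ R, POPO.IsBoundedReward ρ r Rmax := fun r hr =>
    POPO.isBoundedReward_of_linear hφ hφi hφ1 (hlin r hr)
  have hgibbs : ∀ r (hr : r ∈ R), ∀ᵐ x ∂ρ,
      (πreg r).at x = (POPO.gibbs (hbdd r hr) hβ πref).at x := fun r hr =>
    (hreg r hr).ae_eq_gibbs (hbdd r hr) hβ
  set K := R.sup (fun r => POPO.expKL ρ (πopt r) πref) with hK
  -- With an infinite divergence the right-hand side is infinite, as `β T > 0`, and the event is the
  -- whole space.
  by_cases hKtop : K = ∞
  · have hβT : ENNReal.ofReal (β * T) ≠ 0 := by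
      have : 0 < β * (T : ℝ) := by positivity
      simpa using this
    have huniv : ∀ a b : ℝ≥0∞, ENNReal.ofReal 6300 * (a + b + ENNReal.ofReal (β * T) * K) = ∞ := by
      intro a b
      rw [hKtop, ENNReal.mul_top hβT, add_top, ENNReal.mul_top (by norm_num)]
    simp only [huniv, le_top, Set.ofPred_true, measure_univ]
    exact ENNReal.ofReal_le_one.2 (by linarith)
  have hG : ∀ r ∈ R, ∫ x, POPO.rewardSup r x ∂ρ - ∫ x, POPO.softValue β πref r x ∂ρ
      ≤ β * K.toReal := by
    intro r hr
    have hle : POPO.expKL ρ (πopt r) πref ≤ K :=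
      Finset.le_sup (f := fun r => POPO.expKL ρ (πopt r) πref) hr
    have hne : POPO.expKL ρ (πopt r) πref ≠ ∞ := ne_top_of_le_ne_top hKtop hle
    refine (POPO.integral_rewardSup_sub_softValue_le (hbdd r hr) hβ (hopt r hr) hne).trans ?_
    gcongr
  set bad : Set Ω := {ω | ∃ r ∈ R, ∃ t ≤ T, L < ∑ s ∈ Finset.range t,
      ((POPO.logLik r (z s ω) - POPO.logLik rstar (z s ω)) / 2
        + POPO.hellingerGap ρ r rstar (π s ω) πsam)} with hbad
  have hPbad : P bad ≤ ENNReal.ofReal δ :=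
    hrun.measure_exists_logLik_gt_le (R.finite_toSet.image _) (fun r hr => (hbdd r hr).measurable)
      hrstar hδ
  set null : Set Ω := {ω | ¬ ∀ r ∈ R, ∀ n ≤ T, POPO.dpoLoss β πref (πreg r) (fun s => z s ω) n
      = -∑ s ∈ Finset.range n, POPO.logLik r (z s ω)} with hnull
  have hPnull : P null = 0 := hrun.ae_dpoLoss_eq hsam hbdd hβ hgibbs
  -- Only one `δ` is spent: the loss identity fails on a null set.
  have hgood : ENNReal.ofReal (1 - 2 * δ) ≤ P (bad ∪ null)ᶜ := by
    have h1 : P (bad ∪ null) ≤ ENNReal.ofReal δ := by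
      refine (measure_union_le _ _).trans ?_
      rw [hPnull, add_zero]; exact hPbad
    have h2 : 1 ≤ P (bad ∪ null) + P (bad ∪ null)ᶜ := by
      rw [← measure_univ (μ := P), ← Set.union_compl_self (bad ∪ null)]
      exact measure_union_le _ _
    calc ENNReal.ofReal (1 - 2 * δ) ≤ ENNReal.ofReal (1 - δ) :=
          ENNReal.ofReal_le_ofReal (by linarith)
      _ = 1 - ENNReal.ofReal δ := by rw [ENNReal.ofReal_sub _ hδ.le, ENNReal.ofReal_one]
      _ ≤ P (bad ∪ null)ᶜ := by
          rw [tsub_le_iff_left]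
          exact h2.trans (by gcongr)
  refine hgood.trans (measure_mono fun ω hω => ?_)
  simp only [Set.compl_union, Set.mem_inter_iff, Set.mem_compl_iff, hbad, hnull,
    Set.mem_ofPred_eq, not_exists, not_and, not_lt, not_not] at hω
  obtain ⟨hconc, hloss⟩ := hω
  have hreg := POPO.prefRegret_le hd hRmax hφ hφ1 hsam hlin hrstar hβ hbdd hgibbs hG hT0 hα0 hL0.le
    (p := fun t => π t ω) (z := fun s => z s ω) (fun t ht => hrun.mem_class t ht ω)
    (fun t ht => by have h := hrun.isMax t ht ω; rwa [hγ] at h) hloss hconc (πopt rstar)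
  have hrate := POPO.rate_le hdR hTR hRmax hL rfl rfl
  set S := √(d * Rmax * T * Real.log (T * Rmax / d) * L)
  set E := d * Real.exp Rmax * Real.log (T * Rmax / d) * L with hE
  have hE0 : 0 ≤ E := by
    have h1 : 0 ≤ Real.log (T * Rmax / d) := Real.log_nonneg (by
      rw [le_div_iff₀ (by linarith)]; nlinarith)
    positivity
  have hS0 : 0 ≤ S := Real.sqrt_nonneg _
  have hβK : 0 ≤ β * T * K.toReal := by positivity
  change ENNReal.ofReal _ ≤ ENNReal.ofReal 6300 *
    (ENNReal.ofReal S + ENNReal.ofReal E + ENNReal.ofReal (β * T) * K)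
  rw [← ENNReal.ofReal_toReal hKtop, ← ENNReal.ofReal_mul (by positivity),
    ← ENNReal.ofReal_add hS0 hE0, ← ENNReal.ofReal_add (by positivity) hβK,
    ← ENNReal.ofReal_mul (by norm_num)]
  refine ENNReal.ofReal_le_ofReal (hreg.trans ?_)
  linarith
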